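/- Let $T_1$ be a radial infinite rooted metric tree with root $O$: every vertex of generation $j\ge 0$ has $k_j\ge 1$ children, and every edge of generation $j$ (joining a vertex of generation $j$ to one of generation $j+1$) has length $\ell_j>0$. (A regular tree is the case $k_j=k$ for all $j$.) Assume that the radius $\sup_{x\in T_1}|x|$, $|x|=\mathrm{dist}(O,x)$, is finite. Let $g_j=k_0k_1\cdots k_j$ be the number of edges of generation $j$. Let $\rho>0$ be a weight that equals a constant $\rho_j$ on every edge of generation $j$, and assume that there is $C>0$ with $$C\,g_i\,\rho_i\le g_j\,\rho_j\qquad\text{for all } i\le j .$$ For $n\ge 1$ let $\rho_{1,n},\rho_{2,n}$ be measurable weights on $T_1$ such that, for a constant $c>0$ independent of $n$, $c^{-1}\le \rho_{i,n}/\rho\le c$ on all open edges ($i=1,2$), and such that, for a constant $M$ independent of $n$, $\rho_{1,n}(x)=\rho_{2,n}(x)=\rho(x)$ at every point $x$ of an open edge whose distance in $T_1$ to each vertex $v$ is greater than $M\ell_{\mathrm{gen}(v)}/n$. Let $W_n$ ($n\ge1$) be continuous real functions on $T_1$ with $|W_n|\le C_W$ for a constant $C_W$ independent of $n$, and let $W$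 be a real function with $W_n\to W$ almost everywhere. Let $C_0^1(T_1)$ be the set of continuous complex functions on $T_1$ that are continuously differentiable on each closed edge, vanish at the root $O$ and vanish outside finitely many generations. For a weight $w$ let $L^2_w(T_1)$ have the inner product $\langle u,v\rangle_w=\int_{T_1}u\bar v\,w\,d\theta$, and let $H^1_{0,w}(T_1)$ be the completion of $C_0^1(T_1)$ in the norm $\big(\int_{T_1}(|u'|^2+|u|^2)\,w\,d\theta\big)^{1/2}$. Let $A_n$ be the operator in $L^2_{\rho_{2,n}}(T_1)$ defined by the form $$\langle A_nu,v\rangle_{\rho_{2,n}}=\int_{T_1}\big(u'\bar v'\rho_{1,n}+W_n\,u\bar v\,\rho_{2,n}\big)\,d\theta\qquad\text{on } H^1_{0,\rho_{2,n}}(T_1),$$ that is, $u\in\mathrm{Dom}(A_n)$ and $A_nu=f$ if and only if $u\in H^1_{0,\rho_{2,n}}(T_1)$, $f\in L^2_{\rho_{2,n}}(T_1)$ and the right-hand side equals $\langle f,v\rangle_{\rho_{2,n}}$ for all $v\in H^1_{0,\rho_{2,n}}(T_1)$. Let $A$ be the operator in $L^2_\rho(T_1)$ defined in the same way by the form $\int_{T_1}(u'\bar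 v'+W u\bar v)\,\rho\,d\theta$ on $H^1_{0,\rho}(T_1)$. Then all $A_n$ and $A$ have purely discrete spectrum: each has an orthonormal basis of eigenfunctions whose eigenvalues, listed in nondecreasing order with multiplicity, tend to $+\infty$. If $\lambda_{m,n}$ and $\lambda_m$ denote the $m$-th eigenvalues of $A_n$ and $A$ in these lists, then $$\lim_{n\to\infty}\lambda_{m,n}=\lambda_m\qquad\text{for every } m.$$ -/

import Mathlib

open MeasureTheory Filter Topology

noncomputable section

/-- A radial infinite rooted metric tree: every vertex of generation `j` has `deg j` children and
every edge of generation `j` (joining generations `j` and `j + 1`) has length `len j`.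
A regular tree is the case in which `deg` is constant. -/
structure RadialTree where
  deg : ℕ → ℕ
  deg_pos : ∀ j, 1 ≤ deg j
  len : ℕ → ℝ
  len_pos : ∀ j, 0 < len j

namespace RadialTree

variable (T : RadialTree)

/-- A vertex of generation `j` is the word of the `j` choices made on the way down from the root
(the root is the empty word). -/
def Vertex : Type := Σ j : ℕ, ((i : Fin j) → Fin (T.deg i))

/-- An edge of generation `j` is labelled by the word of its lower end point, which is a vertex of
generation `j + 1`. -/
def Edge : Type := Σ j : ℕ, ((i : Fin (j + 1)) → Fin (T.deg i))

instance : MeasurableSpace T.Edge := ⊤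

variable {T}

/-- The generation of a vertex. -/
def Vertex.gen (v : T.Vertex) : ℕ := v.1

/-- The generation of an edge. -/
def Edge.gen (e : T.Edge) : ℕ := e.1

/-- The end point of an edge that is nearer to the root. -/
def Edge.top (e : T.Edge) : T.Vertex := ⟨e.1, fun i => e.2 i.castSucc⟩

/-- The end point of an edge that is farther from the root. -/
def Edge.bot (e : T.Edge) : T.Vertex := ⟨e.1 + 1, e.2⟩

/-- The length of an edge. -/
def Edge.length (e : T.Edge) : ℝ := T.len e.gen

variable (T)

/-- The number of edges of generation `j`, i.e. the value of the counting function on the open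
edges of generation `j`. -/
def edgeCount (j : ℕ) : ℕ := Fintype.card ((i : Fin (j + 1)) → Fin (T.deg i))

/-- The distance from the root to a vertex of generation `j`. -/
def height (j : ℕ) : ℝ := ∑ i ∈ Finset.range j, T.len i

/-- Edge coordinates: `(e, t)` with `0 ≤ t ≤ |e|` is the point of the edge `e` at distance `t` from
its upper end point. Functions on the tree are written in these coordinates; values at other `t`
play no role. -/
abbrev Point : Type := T.Edge × ℝ

/-- The union of all open edges (the tree without its vertices). -/
def body : Set T.Point := {x | 0 < x.2 ∧ x.2 < x.1.length}

variable {T}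

/-- The distance `|x|` of a point from the root. -/
def absPt (x : T.Point) : ℝ := T.height x.1.gen + x.2

/-- The length of the longest common prefix of the words of `e` and `v`. -/
def meetGen (e : T.Edge) (v : T.Vertex) : ℕ :=
  sSup {p : ℕ | p ≤ e.1 + 1 ∧ p ≤ v.1 ∧
    ∀ (i : ℕ) (h₁ : i < e.1 + 1) (h₂ : i < v.1), i < p → (e.2 ⟨i, h₁⟩ : ℕ) = v.2 ⟨i, h₂⟩}

/-- The length of the path in the tree from the point `x` to the vertex `v`, which is
`|x| + |v| - 2 |x ∧ v|` where `x ∧ v` is the last common point of the paths from the root to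
`x` and to `v`. -/
def distVertex (x : T.Point) (v : T.Vertex) : ℝ :=
  absPt x + T.height v.gen - 2 * min (absPt x) (T.height (meetGen x.1 v))

variable (T)

/-- The tree has finite radius `sup |x|`. -/
def FiniteRadius : Prop := BddAbove (absPt '' T.body)

/-- Length measure on the tree: `∫ f dθ = ∑_e ∫_0^{|e|} f (e, t) dt`. -/
def lengthMeasure : Measure T.Point :=
  ((Measure.count : Measure T.Edge).prod (volume : Measure ℝ)).restrict T.body

/-- The measure `ρ dθ`. -/
def weighted (ρ : T.Point → ℝ) : Measure T.Point :=
  T.lengthMeasure.withDensity fun x => ENNReal.ofReal (ρ x)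

/-- The complex Hilbert space `L²_ρ` of the tree. -/
abbrev L2 (ρ : T.Point → ℝ) : Type := Lp ℂ 2 (T.weighted ρ)

variable {T}

/-- A function is continuous on the tree: continuous on each closed edge, with one common value at
each vertex. -/
def IsContinuous {E : Type} [TopologicalSpace E] (f : T.Point → E) : Prop :=
  (∀ e : T.Edge, ContinuousOn (fun t => f (e, t)) (Set.Icc 0 e.length)) ∧
    ∃ val : T.Vertex → E, ∀ e : T.Edge, f (e, 0) = val e.top ∧ f (e, e.length) = val e.bot

/-- `C¹_0` of the tree: continuous functions, continuously differentiable on each closed edge,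
which vanish at the root and have compact support in the tree (vanish on all edges of large
generation). -/
structure IsC10 (f : T.Point → ℂ) : Prop where
  continuous : IsContinuous f
  contDiffOn : ∀ e : T.Edge, ContDiffOn ℝ 1 (fun t => f (e, t)) (Set.Icc 0 e.length)
  root : ∀ e : T.Edge, e.gen = 0 → f (e, 0) = 0
  compactSupport : ∃ J : ℕ, ∀ e : T.Edge, J ≤ e.gen → ∀ t ∈ Set.Icc 0 e.length, f (e, t) = 0

/-- The derivative along the edges. -/
def edgeDeriv (f : T.Point → ℂ) : T.Point → ℂ := fun x => deriv (fun t => f (x.1, t)) x.2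

/-- `H¹_{0,ρ}`: the completion of `C¹_0` in the norm `(∫ (|f'|² + |f|²) ρ dθ)^{1/2}`, realised as the
closure in `L²_ρ × L²_ρ` of the pairs `(f, f')`. Its elements are the pairs `(u, u')`. -/
def H10 (ρ : T.Point → ℝ) : Set (T.L2 ρ × T.L2 ρ) :=
  closure {p | ∃ f : T.Point → ℂ, IsC10 f ∧
    p.1 =ᵐ[T.weighted ρ] f ∧ p.2 =ᵐ[T.weighted ρ] edgeDeriv f}

/-- The form `E(u, v) = ∫ (u' v̄' ρ₁ + W u v̄ ρ₂) dθ`, for `p = (u, u')` and `q = (v, v')`. -/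
def energyForm (ρ₁ ρ₂ W : T.Point → ℝ) (p q : T.L2 ρ₂ × T.L2 ρ₂) : ℂ :=
  ∫ x, (p.2 x * star (q.2 x) * (ρ₁ x : ℂ) + (W x : ℂ) * p.1 x * star (q.1 x) * (ρ₂ x : ℂ))
    ∂T.lengthMeasure

/-- The graph in `L²_{ρ₂} × L²_{ρ₂}` of the width-weighted operator `A` of the form `E` on
`H¹_{0,ρ₂}`: `u ∈ Dom A` and `A u = f` iff `u ∈ H¹_{0,ρ₂}` and `E(u, v) = ⟨f, v⟩_{ρ₂}` for all
`v ∈ H¹_{0,ρ₂}`. (Mathlib's inner product is conjugate linear in its first argument.) -/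
def operatorGraph (ρ₁ ρ₂ W : T.Point → ℝ) : Set (T.L2 ρ₂ × T.L2 ρ₂) :=
  {a | ∃ u' : T.L2 ρ₂, (a.1, u') ∈ H10 ρ₂ ∧
    ∀ q ∈ H10 ρ₂, energyForm ρ₁ ρ₂ W (a.1, u') q = inner ℂ q.1 a.2}

end RadialTree

/-- The operator with graph `G` has purely discrete spectrum and `ev 0 ≤ ev 1 ≤ …` are its
eigenvalues, repeated according to multiplicity: `ev` is nondecreasing and unbounded and there is a
Hilbert basis of corresponding eigenvectors. -/
def IsEigenvalueSequence {H : Type} [NormedAddCommGroup H] [InnerProductSpace ℂ H]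
    (G : Set (H × H)) (ev : ℕ → ℝ) : Prop :=
  Monotone ev ∧ Tendsto ev atTop atTop ∧
    ∃ φ : HilbertBasis ℕ ℂ H, ∀ m, (φ m, (ev m : ℂ) • φ m) ∈ G

end

/-! The eigenvalues converge by the min-max principle, once all operators are read on one space.
Since every weight is comparable to $\rho$, the spaces $L^2_{\rho_{2,n}}$ and $H^1_{0,\rho_{2,n}}$
coincide with $H=L^2_\rho$ and $V=H^1_{0,\rho}$ up to equivalent norms. With $j$ the embedding $V\to
H$ and $\pi$ the derivative, the $n$-th problem becomes $\langle\pi q,A_n\pi v\rangle+\langle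
jq,Q_njv\rangle=\lambda\langle jq,R_njv\rangle$, where $A_n,Q_n,R_n$ multiply by $\rho_{1,n}/\rho$,
$W_n\rho_{2,n}/\rho$, $\rho_{2,n}/\rho$ (`IsMinMaxSystem`, `IsWeight.isMinMaxSystem_transport`).
Each point of an open edge eventually leaves the shrinking vertex neighbourhoods, so the multipliers
converge almost everywhere and boundedly, and the operators converge strongly (`tendsto_mulOp`).

Strong convergence suffices because $j$ is compact (`tendsto_eigenvalues`). For the upper bound, the
span of the first $m+1$ limit eigenfunctions is a test space on which the matrices of the forms
converge. For the lower bound, suppose $\lambda_{m,n}\le\lambda_m-\varepsilon$ for arbitrarily large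
$n$. Along an ultrafilter the first $m+1$ eigenvectors converge weakly in $V$, hence strongly in
$H$; their limits stay orthonormal, and lower semicontinuity of the derivative part makes the limit
quotient at most $\lambda_m-\varepsilon$ on their span, which contradicts min-max.

Compactness of $j$ rests on a Hardy-type bound (`IsC10.mul_levelSum_le`). The root mean square of
$f$ over a generation does not jump at vertices, and it vanishes far out. Summing its increments and
applying Cauchy–Schwarz with the growth of $g_j\rho_j$ bounds $f$ below generation $J$ by the energy
times the remaining height, which tends to zero because the radius is finite. The finitely many
edges above are handled by step functions. Discreteness of the spectra then follows from the
spectral theorem for the compact operator $jB^{-1}j^*$, with $B$ the form shifted to be coercive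
(`exists_form_eigenbasis`). -/

open scoped ContDiff

noncomputable section

/-! ### Listing a family with finite sublevel sets in nondecreasing order -/

section Enumeration

/-- An infinite family of reals with finite sublevel sets can be listed in nondecreasing order. -/
theorem exists_equiv_nat_monotone {ι : Type*} [Infinite ι] (f : ι → ℝ)
    (hf : ∀ c, {i | f i ≤ c}.Finite) : ∃ e : ℕ ≃ ι, Monotone (f ∘ e) := by
  classical
  have hcount : Countable ι := by
    rw [← Set.countable_univ_iff]
    have : (Set.univ : Set ι) = ⋃ n : ℕ, {i | f i ≤ n} := by
      ext i
      simpa using exists_nat_ge (f i)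
    rw [this]
    exact Set.countable_iUnion fun n => (hf n).countable
  obtain ⟨g, hg⟩ := exists_injective_nat ι
  -- Ties of `f` are broken by the injection `g` into `ℕ`. This gives a strict total order with
  -- finite initial segments, so counting predecessors embeds `ι` into `ℕ` compatibly with `f`.
  set r : ι → ι → Prop := fun i j => f i < f j ∨ (f i = f j ∧ g i < g j) with hr
  have hfin : ∀ k, {j | r j k}.Finite := fun k => (hf (f k)).subset fun j hj => by
    rcases hj with h | h
    · exact h.le
    · exact h.1.le
  have htrans : ∀ i j k, r i j → r j k → r i k := by
    intro i j k hij hjk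
    simp only [hr] at *
    grind
  have hirr : ∀ i, ¬ r i i := by
    intro i
    simp [hr]
  have htri : ∀ i j, i ≠ j → r i j ∨ r j i := by
    intro i j hij
    have := hg.ne hij
    simp only [hr]
    grind
  set rank : ι → ℕ := fun k => {j | r j k}.ncard with hrank
  have hlt : ∀ i k, r i k → rank i < rank k := fun i k hik =>
    Set.ncard_lt_ncard ⟨fun j hj => htrans j i k hj hik, fun h => hirr i (h hik)⟩ (hfin k)
  have hinj : Function.Injective rank := by
    intro i j hij
    by_contra h
    rcases htri i j h with h | h
    · exact (hlt _ _ h).ne hij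
    · exact (hlt _ _ h).ne' hij
  have hle : ∀ i k, rank i ≤ rank k → f i ≤ f k := by
    intro i k hik
    by_contra! h
    exact absurd (hlt k i (Or.inl h)) (by omega)
  have : Infinite (Set.range rank) := (Set.infinite_range_of_injective hinj).to_subtype
  refine ⟨(Nat.Subtype.orderIsoOfNat (Set.range rank)).toEquiv.trans
    (Equiv.ofInjective rank hinj).symm, fun a b hab => hle _ _ ?_⟩
  have key : ∀ s : Set.range rank, rank ((Equiv.ofInjective rank hinj).symm s) = s :=
    fun s => Equiv.apply_ofInjective_symm hinj s
  simp only [Equiv.trans_apply, key]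
  exact (Nat.Subtype.orderIsoOfNat (Set.range rank)).monotone hab

end Enumeration

/-! ### Spectral theory of compact operators and of coercive forms -/

section Spectral

open Module.End

variable {H : Type*} [NormedAddCommGroup H] [InnerProductSpace ℂ H]

/-- A compact operator maps only finitely many members of an orthonormal family to vectors of the
form `μ • v` with `ε ≤ ‖μ‖`. -/
theorem IsCompactOperator.finite_setOf_le_norm {T : H →L[ℂ] H} (hT : IsCompactOperator T)
    {ι : Type*} {φ : ι → H} (hφ : Orthonormal ℂ φ) (μ : ι → ℂ) (hμ : ∀ i, T (φ i) = μ i • φ i)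
    {ε : ℝ} (hε : 0 < ε) : {i | ε ≤ ‖μ i‖}.Finite := by
  obtain ⟨K, hK, hKT⟩ := IsCompactOperator.image_closedBall_subset_compact (f := (T : H →ₗ[ℂ] H)) hT 1
  obtain ⟨t, htf, ht⟩ := Metric.totallyBounded_iff.1 hK.totallyBounded (ε / 2) (half_pos hε)
  by_contra hinf
  have hcov : ∀ i, ∃ y ∈ t, T (φ i) ∈ Metric.ball y (ε / 2) := fun i => by
    have : T (φ i) ∈ K := hKT ⟨φ i, by simp [hφ.1 i], rfl⟩
    simpa using ht this
  choose y hyt hy using hcov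
  -- Pigeonhole: two of infinitely many images share a ball of radius `ε / 2`. Pairing their
  -- difference with `φ i` shows that they are at least `‖μ i‖ ≥ ε` apart.
  obtain ⟨i, hi, j, hj, hij, hyij⟩ :=
    Set.Infinite.exists_ne_map_eq_of_mapsTo hinf (fun i _ => hyt i) htf
  have h1 : dist (T (φ i)) (T (φ j)) < ε := by
    have h1 := hy i
    have h2 := hy j
    rw [← hyij] at h2
    rw [Metric.mem_ball] at h1 h2
    linarith [dist_triangle_right (T (φ i)) (T (φ j)) (y i)]
  have h2 : ‖μ i‖ ≤ dist (T (φ i)) (T (φ j)) := by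
    rw [dist_eq_norm, hμ, hμ]
    have h3 : inner ℂ (φ i) (μ i • φ i - μ j • φ j) = μ i := by
      rw [inner_sub_right, inner_smul_right, inner_smul_right, hφ.2 hij,
        inner_self_eq_norm_sq_to_K, hφ.1 i]
      simp
    calc ‖μ i‖ = ‖inner ℂ (φ i) (μ i • φ i - μ j • φ j)‖ := by rw [h3]
      _ ≤ ‖φ i‖ * ‖μ i • φ i - μ j • φ j‖ := norm_inner_le_norm _ _
      _ = _ := by rw [hφ.1 i, one_mul]
  have h3 : ε ≤ ‖μ i‖ := hi
  linarith

/-- The spectral theorem for an injective, positive, compact operator on an infinite-dimensional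
Hilbert space, with the inverse eigenvalues listed in nondecreasing order. -/
theorem IsCompactOperator.exists_hilbertBasis_nat [CompleteSpace H] {T : H →L[ℂ] H} (hT : IsCompactOperator T)
    (hsymm : T.IsSymmetric) (hpos : ∀ x, 0 ≤ (inner ℂ x (T x)).re) (hinj : Function.Injective T)
    (hdim : ¬ FiniteDimensional ℂ H) :
    ∃ (ev : ℕ → ℝ) (φ : HilbertBasis ℕ ℂ H), Monotone ev ∧ Tendsto ev atTop atTop ∧
      ∀ m, (ev m : ℂ) • T (φ m) = φ m := by
  classical
  have hker : eigenspace (T : Module.End ℂ H) 0 = ⊥ := by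
    rw [eigenspace_zero]
    exact LinearMap.ker_eq_bot.2 hinj
  have hfd : ∀ μ : ℂ, FiniteDimensional ℂ (eigenspace (T : Module.End ℂ H) μ) := by
    intro μ
    by_cases hμ : μ = 0
    · subst hμ
      rw [hker]
      infer_instance
    · exact ContinuousLinearMap.finite_dimensional_eigenspace hT μ hμ
  -- All complex numbers are allowed as labels; those that are not eigenvalues contribute an empty
  -- fibre.
  let ι := Σ μ : ℂ, Fin (Module.finrank ℂ (eigenspace (T : Module.End ℂ H) μ))
  let ψ : ι → H := fun a => (stdOrthonormalBasis ℂ (eigenspace (T : Module.End ℂ H) a.1) a.2 : H)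
  have hψ : Orthonormal ℂ ψ :=
    (LinearMap.IsSymmetric.orthogonalFamily_eigenspaces hsymm).orthonormal_sigma_orthonormal
      (fun μ => (stdOrthonormalBasis ℂ (eigenspace (T : Module.End ℂ H) μ)).orthonormal)
  have hTψ : ∀ a : ι, T (ψ a) = a.1 • ψ a := fun a =>
    mem_eigenspace_iff.1 (stdOrthonormalBasis ℂ (eigenspace (T : Module.End ℂ H) a.1) a.2).2
  have hψ1 : ∀ a, ‖ψ a‖ = 1 := hψ.1
  have hψ0 : ∀ a, ψ a ≠ 0 := fun a h => by simpa [h] using hψ1 a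
  have hreal : ∀ a : ι, ((a.1.re : ℝ) : ℂ) = a.1 := by
    intro a
    have : HasEigenvalue (T : Module.End ℂ H) a.1 :=
      hasEigenvalue_of_hasEigenvector ⟨mem_eigenspace_iff.2 (hTψ a), hψ0 a⟩
    exact Complex.conj_eq_iff_re.1 (LinearMap.IsSymmetric.conj_eigenvalue_eq_self hsymm this)
  have hne : ∀ a : ι, a.1 ≠ 0 := by
    intro a h
    have := hTψ a
    rw [h, zero_smul] at this
    exact hψ0 a (hinj (by rw [this, map_zero]))
  have hpos' : ∀ a : ι, 0 < a.1.re := by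
    intro a
    have h := hpos (ψ a)
    rw [hTψ, inner_smul_right, inner_self_eq_norm_sq_to_K, hψ1] at h
    refine lt_of_le_of_ne (by simpa using h) fun h0 => hne a ?_
    rw [← hreal a, ← h0, Complex.ofReal_zero]
  have hspan : ∀ x : H, (∀ a, inner ℂ (ψ a) x = 0) → x = 0 := by
    intro x hx
    have : x ∈ (⨆ μ, eigenspace (T : Module.End ℂ H) μ)ᗮ := by
      rw [← Submodule.iInf_orthogonal, Submodule.mem_iInf]
      intro μ y hy
      have hy' := (stdOrthonormalBasis ℂ (eigenspace (T : Module.End ℂ H) μ)).sum_repr ⟨y, hy⟩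
      have hy'' := congrArg (Submodule.subtype _) hy'
      simp only [map_sum, map_smul, Submodule.subtype_apply] at hy''
      rw [← hy'', sum_inner]
      refine Finset.sum_eq_zero fun i _ => ?_
      rw [inner_smul_left]
      exact mul_eq_zero_of_right _ (hx ⟨μ, i⟩)
    rw [ContinuousLinearMap.orthogonalComplement_iSup_eigenspaces_eq_bot hT hsymm] at this
    simpa using this
  have hbot : (Submodule.span ℂ (Set.range ψ))ᗮ = ⊥ := by
    rw [Submodule.eq_bot_iff]
    intro x hx
    exact hspan x fun a => hx _ (Submodule.subset_span ⟨a, rfl⟩)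
  have hinfι : Infinite ι := by
    by_contra h
    rw [not_infinite_iff_finite] at h
    have := Fintype.ofFinite ι
    exact hdim (HilbertBasis.mkOfOrthogonalEqBot hψ hbot).toOrthonormalBasis.toBasis.finiteDimensional_of_finite
  -- For `c > 0`, an inverse eigenvalue at most `c` means an eigenvalue at least `c⁻¹`, and
  -- compactness leaves finitely many of these.
  have hsub : ∀ c, {a : ι | (a.1.re)⁻¹ ≤ c}.Finite := by
    intro c
    rcases le_or_gt c 0 with hc | hc
    · refine Set.Finite.subset Set.finite_empty fun a ha => ?_
      have : 0 < (a.1.re)⁻¹ := inv_pos.2 (hpos' a)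
      exact absurd (show (a.1.re)⁻¹ ≤ c from ha) (by linarith)
    · refine (hT.finite_setOf_le_norm hψ (fun a => a.1) hTψ (inv_pos.2 hc)).subset fun a ha => ?_
      have h1 : (a.1.re)⁻¹ ≤ c := ha
      have h2 : c⁻¹ ≤ a.1.re := inv_le_of_inv_le₀ (hpos' a) h1
      exact h2.trans (Complex.re_le_norm _)
  obtain ⟨e, he⟩ := exists_equiv_nat_monotone (fun a : ι => (a.1.re)⁻¹) hsub
  have hrange : Set.range (ψ ∘ e) = Set.range ψ := e.surjective.range_comp ψ
  refine ⟨fun m => ((e m).1.re)⁻¹, HilbertBasis.mkOfOrthogonalEqBot (v := ψ ∘ e)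
    (hψ.comp e e.injective) (by rw [hrange]; exact hbot), he, ?_, fun m => ?_⟩
  · rw [← Nat.cofinite_eq_atTop]
    have : Tendsto (fun a : ι => (a.1.re)⁻¹) cofinite atTop := by
      rw [tendsto_atTop]
      intro b
      rw [eventually_cofinite]
      exact (hsub b).subset fun a ha => (not_le.1 ha).le
    exact this.comp e.injective.tendsto_cofinite
  · rw [HilbertBasis.coe_mkOfOrthogonalEqBot, Function.comp_apply, hTψ, smul_smul]
    conv_lhs => rw [← hreal (e m)]
    rw [← Complex.ofReal_mul, inv_mul_cancel₀ (hpos' _).ne', Complex.ofReal_one, one_smul]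

variable {V : Type*} [NormedAddCommGroup V] [InnerProductSpace ℂ V] [CompleteSpace V]

/-- The eigenvalue problem `⟨q, B v⟩ = λ ⟨j q, j v⟩` for a coercive symmetric form `B` on a Hilbert
space `V` that is compactly and densely mapped to `H` has purely discrete spectrum. -/
theorem exists_form_eigenbasis [CompleteSpace H] (j : V →L[ℂ] H) (hj : IsCompactOperator j) (hdense : DenseRange j)
    (hdim : ¬ FiniteDimensional ℂ H) (B : V →L[ℂ] V) (hB : B.IsSymmetric) {α : ℝ} (hα : 0 < α)
    (hcoer : ∀ v, α * ‖v‖ ^ 2 ≤ (inner ℂ v (B v)).re) :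
    ∃ (ev : ℕ → ℝ) (φ : HilbertBasis ℕ ℂ H), Monotone ev ∧ Tendsto ev atTop atTop ∧
      ∀ m, ∃ v, j v = φ m ∧ ∀ q, inner ℂ q (B v) = (ev m : ℂ) * inner ℂ (j q) (φ m) := by
  obtain ⟨U, hU⟩ := B.isUnit_of_forall_le_norm_inner_map (c := ⟨α, hα.le⟩) hα (fun x => by
    have hx : inner ℂ (B x) x = inner ℂ x (B x) := hB x x
    rw [hx]
    exact (mul_comm (‖x‖ ^ 2) α).le.trans ((hcoer x).trans (Complex.re_le_norm _)))
  set S : V →L[ℂ] V := ↑U⁻¹ with hS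
  have hBS : ∀ v, B (S v) = v := fun v => by
    have := congrArg (fun A : V →L[ℂ] V => A v) U.mul_inv
    rw [hU] at this
    simpa using this
  have hSsymm : ∀ x y, inner ℂ (S x) y = inner ℂ x (S y) := fun x y => by
    conv_lhs => rw [← hBS y]
    conv_rhs => rw [← hBS x]
    exact (hB _ _).symm
  -- With `S = B⁻¹` the weak equation says `v = λ S j* (j v)`. Hence `φ = j v` is an eigenvector of
  -- `j S j*` for `1 / λ`, and `v` is recovered as `λ S j* φ`. Density of the range of `j` makes
  -- `j*`, and hence `T`, injective.
  set T : H →L[ℂ] H := j ∘L (S ∘L j.adjoint) with hTdef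
  have hTinner : ∀ x y, inner ℂ x (T y) = inner ℂ (j.adjoint x) (S (j.adjoint y)) := fun x y => by
    rw [ContinuousLinearMap.adjoint_inner_left]
    rfl
  have hadj0 : ∀ x, j.adjoint x = 0 → x = 0 := by
    intro x hx
    refine hdense.eq_zero_of_inner_left (𝕜 := ℂ) fun v => ?_
    rw [← ContinuousLinearMap.adjoint_inner_left, hx, inner_zero_left]
  have hST : ∀ v, α * ‖S v‖ ^ 2 ≤ (inner ℂ v (S v)).re := fun v => by
    have := hcoer (S v)
    rwa [hBS, hSsymm] at this
  obtain ⟨ev, φ, h1, h2, h3⟩ := IsCompactOperator.exists_hilbertBasis_nat (T := T)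
    (hj.comp_clm _) (fun x y => by
      have h := hTinner y x
      rw [← inner_conj_symm, ContinuousLinearMap.coe_coe, h, hTinner, ← hSsymm, inner_conj_symm])
    (fun x => by
      rw [hTinner]
      exact le_trans (by positivity) (hST _))
    (by
      rw [injective_iff_map_eq_zero]
      intro x hx
      have h := hTinner x x
      rw [hx, inner_zero_right] at h
      have h' := hST (j.adjoint x)
      rw [← h] at h'
      have h0 : S (j.adjoint x) = 0 := by
        rw [← norm_eq_zero]
        have : ‖S (j.adjoint x)‖ ^ 2 ≤ 0 := by
          simp only [Complex.zero_re] at h'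
          nlinarith
        exact pow_eq_zero_iff two_ne_zero |>.1 (le_antisymm this (by positivity))
      refine hadj0 x ?_
      rw [← hBS (j.adjoint x), h0, map_zero])
    hdim
  refine ⟨ev, φ, h1, h2, fun m => ⟨(ev m : ℂ) • S (j.adjoint (φ m)), ?_, fun q => ?_⟩⟩
  · rw [map_smul]
    exact h3 m
  · rw [map_smul, hBS, inner_smul_right, ContinuousLinearMap.adjoint_inner_right]

end Spectral

/-! ### The Courant–Fischer principle in abstract form -/

section MinMax

variable {V H : Type*} [NormedAddCommGroup V] [InnerProductSpace ℂ V]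
  [NormedAddCommGroup H] [InnerProductSpace ℂ H]

/-- The variational characterisation of the sequence `ev` of eigenvalues of the generalised problem
`⟨q, B v⟩ = λ ⟨j q, R (j v)⟩`: there are eigenvectors, orthonormal for `R`, and the Rayleigh
quotient on a subspace of dimension `m + 1` is somewhere at least `ev m`. -/
structure IsMinMaxSystem (j : V →L[ℂ] H) (B : V →L[ℂ] V) (R : H →L[ℂ] H) (ev : ℕ → ℝ) : Prop where
  mono : Monotone ev
  exists_eigenvectors : ∃ v : ℕ → V,
    (∀ l k, inner ℂ (v l) (B (v k)) = if l = k then (ev k : ℂ) else 0) ∧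
      ∀ l k, inner ℂ (j (v l)) (R (j (v k))) = if l = k then (1 : ℂ) else 0
  le_of_forall : ∀ (m : ℕ) (Λ : ℝ) (x : Fin (m + 1) → V), LinearIndependent ℂ (fun k => j (x k)) →
    (∀ c : Fin (m + 1) → ℂ, (inner ℂ (∑ k, c k • x k) (B (∑ k, c k • x k))).re ≤
      Λ * (inner ℂ (j (∑ k, c k • x k)) (R (j (∑ k, c k • x k)))).re) → ev m ≤ Λ

/-- Bessel's inequality for a nonnegative symmetric form and finitely many of its eigenvectors. -/
theorem sum_eigenvalue_mul_le {j : V →L[ℂ] H} {B : V →L[ℂ] V} (hB : B.IsSymmetric)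
    (hpos : ∀ v, 0 ≤ (inner ℂ v (B v)).re) {ι : Type*} (s : Finset ι) {φ : ι → H}
    (hφ : Orthonormal ℂ φ) {v : ι → V} (hv : ∀ k, j (v k) = φ k) {ev : ι → ℝ}
    (hev : ∀ k q, inner ℂ q (B (v k)) = (ev k : ℂ) * inner ℂ (j q) (φ k)) (y : V) :
    ∑ k ∈ s, ev k * ‖inner ℂ (φ k) (j y)‖ ^ 2 ≤ (inner ℂ y (B y)).re := by
  classical
  set d : ι → ℂ := fun k => inner ℂ (φ k) (j y) with hd
  -- `z` is the spectral projection of `y`. Both `⟨y, B z⟩` and `⟨z, B z⟩` equal the sum to be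
  -- bounded, so nonnegativity of the form at `y - z` is the claim.
  set z : V := ∑ k ∈ s, d k • v k with hz
  have hyz : inner ℂ y (B z) = ∑ k ∈ s, ((ev k * ‖d k‖ ^ 2 : ℝ) : ℂ) := by
    rw [hz, map_sum, inner_sum]
    refine Finset.sum_congr rfl fun k _ => ?_
    rw [map_smul, inner_smul_right, hev, ← inner_conj_symm, mul_left_comm]
    change _ * (d k * (starRingEnd ℂ) (d k)) = _
    rw [Complex.mul_conj, Complex.normSq_eq_norm_sq]
    push_cast
    ring
  have hjz : ∀ k ∈ s, inner ℂ (φ k) (j z) = d k := by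
    intro k hk
    rw [hz, map_sum]
    simp only [map_smul, hv]
    rw [hφ.inner_right_sum _ hk]
  have hzz : inner ℂ z (B z) = ∑ k ∈ s, ((ev k * ‖d k‖ ^ 2 : ℝ) : ℂ) := by
    conv_lhs => rw [hz, map_sum, ← hz, inner_sum]
    refine Finset.sum_congr rfl fun k hk => ?_
    rw [map_smul, inner_smul_right, hev, ← inner_conj_symm, mul_left_comm, hjz k hk,
      Complex.mul_conj, Complex.normSq_eq_norm_sq]
    push_cast
    ring
  have hzy : (inner ℂ z (B y)).re = (inner ℂ y (B z)).re := by
    have : inner ℂ (B z) y = inner ℂ z (B y) := hB z y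
    rw [← this, ← inner_conj_symm, Complex.conj_re]
  have h := hpos (y - z)
  rw [map_sub, inner_sub_left, inner_sub_right, inner_sub_right, Complex.sub_re, Complex.sub_re,
    Complex.sub_re, hzy, hyz, hzz] at h
  rw [← Complex.ofReal_sum, Complex.ofReal_re] at h
  linarith

/-- The operator of the form shifted by `κ ‖j v‖²`. -/
def shiftOp [CompleteSpace V] [CompleteSpace H] (j : V →L[ℂ] H) (B : V →L[ℂ] V) (κ : ℝ) :
    V →L[ℂ] V :=
  B + (κ : ℂ) • (j.adjoint ∘L j)

theorem inner_shiftOp [CompleteSpace V] [CompleteSpace H] (j : V →L[ℂ] H) (B : V →L[ℂ] V) (κ : ℝ)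
    (q u : V) : inner ℂ q (shiftOp j B κ u) = inner ℂ q (B u) + (κ : ℂ) * inner ℂ (j q) (j u) := by
  simp [shiftOp, ContinuousLinearMap.adjoint_inner_right]

theorem re_inner_shiftOp [CompleteSpace V] [CompleteSpace H] (j : V →L[ℂ] H) (B : V →L[ℂ] V)
    (κ : ℝ) (u : V) :
    (inner ℂ u (shiftOp j B κ u)).re = (inner ℂ u (B u)).re + κ * ‖j u‖ ^ 2 := by
  rw [inner_shiftOp, inner_self_eq_norm_sq_to_K, Complex.add_re]
  congr 1
  rw [Complex.re_ofReal_mul]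
  congr 1
  norm_cast

theorem shiftOp_isSymmetric [CompleteSpace V] [CompleteSpace H] (j : V →L[ℂ] H) {B : V →L[ℂ] V}
    (hB : B.IsSymmetric) (κ : ℝ) : (shiftOp j B κ).IsSymmetric := by
  intro q u
  have h1 : inner ℂ (B u) q = inner ℂ u (B q) := hB u q
  change inner ℂ (shiftOp j B κ q) u = inner ℂ q (shiftOp j B κ u)
  rw [← inner_conj_symm, inner_shiftOp, inner_shiftOp, ← h1]
  simp

/-- The Courant–Fischer principle for an eigenbasis. -/
theorem isMinMaxSystem_of_eigenbasis {j : V →L[ℂ] H} {B : V →L[ℂ] V} (hB : B.IsSymmetric) {κ : ℝ}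
    (hpos : ∀ v, 0 ≤ (inner ℂ v (B v)).re + κ * ‖j v‖ ^ 2) [CompleteSpace V] [CompleteSpace H]
    {ev : ℕ → ℝ} (hmono : Monotone ev) (φ : HilbertBasis ℕ ℂ H)
    (hφ : ∀ m, ∃ v, j v = φ m ∧ ∀ q, inner ℂ q (B v) = (ev m : ℂ) * inner ℂ (j q) (φ m)) :
    IsMinMaxSystem j B (ContinuousLinearMap.id ℂ H) ev := by
  choose v hv hev using hφ
  have horth := orthonormal_iff_ite.1 φ.orthonormal
  refine ⟨hmono, ⟨v, fun l k => ?_, fun l k => ?_⟩, fun m Λ x hx hΛ => ?_⟩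
  · rw [hev, hv, horth]
    split_ifs <;> simp
  · rw [ContinuousLinearMap.id_apply, hv, hv, horth]
  -- Dimension count: `m + 1` coefficients against the `m` conditions of orthogonality to the lower
  -- eigenvectors.
  obtain ⟨c, hc0, hc⟩ : ∃ c : Fin (m + 1) → ℂ, c ≠ 0 ∧
      ∀ i : Fin m, inner ℂ (φ i) (j (∑ k, c k • x k)) = 0 := by
    let L : (Fin (m + 1) → ℂ) →ₗ[ℂ] (Fin m → ℂ) := LinearMap.pi fun i =>
      (innerSL ℂ (φ i)).toLinearMap ∘ₗ j.toLinearMap ∘ₗ (Fintype.linearCombination ℂ x)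
    have hker : L.ker ≠ ⊥ := LinearMap.ker_ne_bot_of_finrank_lt (by simp)
    obtain ⟨c, hc, hc0⟩ := (Submodule.ne_bot_iff _).1 hker
    exact ⟨c, hc0, fun i => congrFun (LinearMap.mem_ker.1 hc) i⟩
  set y := ∑ k, c k • x k with hy
  have hjy : j y ≠ 0 := by
    intro h
    rw [hy, map_sum] at h
    simp only [map_smul] at h
    exact hc0 (funext (Fintype.linearIndependent_iff.1 hx c h))
  -- Bessel's inequality needs a nonnegative form, so it is applied after the shift. The extra `κ ‖j
  -- y‖²` appears on both sides and cancels at the end.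
  set B' := shiftOp j B κ
  have hB'pos := re_inner_shiftOp j B κ
  have hbessel : ∀ N : ℕ, ∑ k ∈ Finset.range N, (ev k + κ) * ‖inner ℂ (φ k) (j y)‖ ^ 2 ≤
      (inner ℂ y (B' y)).re := fun N =>
    sum_eigenvalue_mul_le (ev := fun k => ev k + κ) (shiftOp_isSymmetric j hB κ)
      (fun u => by rw [hB'pos]; exact hpos u) _ φ.orthonormal hv
      (fun k q => by rw [inner_shiftOp, hev, hv]; push_cast; ring) y
  have hparseval : HasSum (fun k => ‖inner ℂ (φ k) (j y)‖ ^ 2) (‖j y‖ ^ 2) := by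
    have h := φ.hasSum_inner_mul_inner (j y) (j y)
    rw [inner_self_eq_norm_sq_to_K] at h
    have h' := Complex.hasSum_re h
    convert h' using 1
    · funext k
      rw [← inner_conj_symm (j y), mul_comm, Complex.mul_conj, Complex.normSq_eq_norm_sq,
        Complex.ofReal_re]
    · norm_cast
  have hlim := (hparseval.mul_left (ev m + κ)).tendsto_sum_nat
  have hle : (ev m + κ) * ‖j y‖ ^ 2 ≤ (inner ℂ y (B' y)).re := by
    refine le_of_tendsto' hlim fun N => (Finset.sum_le_sum fun k _ => ?_).trans (hbessel N)
    rcases lt_or_ge k m with hk | hk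
    · have := hc ⟨k, hk⟩
      simp only at this
      simp [this]
    · gcongr
      exact hmono hk
  have hΛ' := hΛ c
  rw [← hy, ContinuousLinearMap.id_apply, inner_self_eq_norm_sq_to_K] at hΛ'
  have hcast : ((((‖j y‖ : ℝ) : ℂ)) ^ 2).re = ‖j y‖ ^ 2 := by norm_cast
  have hΛ'' : (inner ℂ y (B y)).re ≤ Λ * ‖j y‖ ^ 2 := by
    rw [← hcast]
    exact hΛ'
  rw [hB'pos] at hle
  have hpos' : 0 < ‖j y‖ ^ 2 := by positivity
  by_contra! hlt
  nlinarith

variable {V' H' : Type*} [NormedAddCommGroup V'] [InnerProductSpace ℂ V']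
  [NormedAddCommGroup H'] [InnerProductSpace ℂ H']

/-- Transport of a variational system along isomorphisms intertwining the forms. -/
theorem IsMinMaxSystem.transport {j' : V' →L[ℂ] H'} {B' : V' →L[ℂ] V'} {R' : H' →L[ℂ] H'}
    {ev : ℕ → ℝ} (h : IsMinMaxSystem j' B' R' ev) {j : V →L[ℂ] H} {B : V →L[ℂ] V} {R : H →L[ℂ] H}
    (J : V ≃ₗ[ℂ] V') (K : H →ₗ[ℂ] H') (hK : Function.Injective K) (hJK : ∀ v, j' (J v) = K (j v))
    (hB : ∀ x y, inner ℂ (J x) (B' (J y)) = inner ℂ x (B y))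
    (hR : ∀ x y, inner ℂ (j' (J x)) (R' (j' (J y))) = inner ℂ (j x) (R (j y))) :
    IsMinMaxSystem j B R ev := by
  obtain ⟨hmono, ⟨v, hv1, hv2⟩, hle⟩ := h
  refine ⟨hmono, ⟨fun k => J.symm (v k), fun l k => ?_, fun l k => ?_⟩, fun m Λ x hx hΛ => ?_⟩
  · rw [← hB, J.apply_symm_apply, J.apply_symm_apply, hv1]
  · rw [← hR, J.apply_symm_apply, J.apply_symm_apply, hv2]
  · refine hle m Λ (fun k => J (x k)) ?_ fun c => ?_
    · simp only [hJK]
      exact hx.map' K (LinearMap.ker_eq_bot.2 hK)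
    · have : ∑ k, c k • J (x k) = J (∑ k, c k • x k) := by simp
      rw [this, hB, hR]
      exact hΛ c

end MinMax

/-! ### Weak and strong limits along ultrafilters -/

section WeakLimits

variable {V H : Type*} [NormedAddCommGroup V] [InnerProductSpace ℂ V] [CompleteSpace V]
  [NormedAddCommGroup H] [InnerProductSpace ℂ H] [CompleteSpace H]

/-- A bounded family in a Hilbert space converges weakly along every ultrafilter. -/
theorem exists_weak_limit {ι : Type*} (U : Ultrafilter ι) (x : ι → V) {C : ℝ}
    (hx : ∀ᶠ n in U, ‖x n‖ ≤ C) :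
    ∃ y : V, ∀ q, Tendsto (fun n => inner ℂ (x n) q) U (𝓝 (inner ℂ y q)) := by
  -- By the Riesz representation the family lies in a weak-* compact ball (Banach–Alaoglu), where
  -- every ultrafilter converges.
  let f : ι → WeakDual ℂ V := fun n => StrongDual.toWeakDual (InnerProductSpace.toDual ℂ V (x n))
  have hK := WeakDual.isCompact_closedBall (𝕜 := ℂ) (E := V) 0 C
  obtain ⟨g, -, hg⟩ := hK.ultrafilter_le_nhds (U.map f) (by
    rw [Ultrafilter.coe_map, le_principal_iff, mem_map]
    filter_upwards [hx] with n hn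
    change dist (InnerProductSpace.toDual ℂ V (x n)) 0 ≤ C
    rwa [dist_zero_right, LinearIsometryEquiv.norm_map])
  refine ⟨(InnerProductSpace.toDual ℂ V).symm (WeakDual.toStrongDual g), fun q => ?_⟩
  have h1 : Tendsto f U (𝓝 g) := hg
  have h2 := (WeakDual.eval_continuous q).tendsto g |>.comp h1
  rw [InnerProductSpace.toDual_symm_apply]
  exact h2

/-- Compact operators turn weak into strong convergence (along ultrafilters). -/
theorem IsCompactOperator.tendsto_of_weak {j : V →L[ℂ] H} (hj : IsCompactOperator j) {ι : Type*}
    (U : Ultrafilter ι) (x : ι → V) {C : ℝ} (hx : ∀ᶠ n in U, ‖x n‖ ≤ C) {y : V}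
    (hy : ∀ q, Tendsto (fun n => inner ℂ (x n) q) U (𝓝 (inner ℂ y q))) :
    Tendsto (fun n => j (x n)) U (𝓝 (j y)) := by
  obtain ⟨K, hK, hKj⟩ :=
    IsCompactOperator.image_closedBall_subset_compact (f := (j : V →ₗ[ℂ] H)) hj C
  obtain ⟨h, -, hh⟩ := hK.ultrafilter_le_nhds (U.map fun n => j (x n)) (by
    rw [Ultrafilter.coe_map, le_principal_iff, mem_map]
    filter_upwards [hx] with n hn
    exact hKj ⟨x n, by simpa using hn, rfl⟩)
  have h1 : Tendsto (fun n => j (x n)) U (𝓝 h) := hh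
  -- Compactness provides some strong limit `h`; testing through the adjoint identifies it with the
  -- image of the weak limit.
  have h2 : h = j y := by
    refine ext_inner_right ℂ fun g => ?_
    have h3 : Tendsto (fun n => inner ℂ (j (x n)) g) U (𝓝 (inner ℂ h g)) :=
      h1.inner tendsto_const_nhds
    have h4 := hy (j.adjoint g)
    simp only [ContinuousLinearMap.adjoint_inner_right] at h4
    exact tendsto_nhds_unique h3 h4
  rwa [← h2]

end WeakLimits

section StrongLimits

variable {H : Type*} [NormedAddCommGroup H] [InnerProductSpace ℂ H]

/-- Strong convergence of uniformly bounded operators, applied to a convergent family. -/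
theorem tendsto_apply_of_strong {ι : Type*} {l : Filter ι} {A : ι → H →L[ℂ] H} {A₀ : H →L[ℂ] H}
    {K : ℝ} (hK : ∀ᶠ n in l, ‖A n‖ ≤ K) (hA : ∀ h, Tendsto (fun n => A n h) l (𝓝 (A₀ h)))
    {y : ι → H} {y₀ : H} (hy : Tendsto y l (𝓝 y₀)) :
    Tendsto (fun n => A n (y n)) l (𝓝 (A₀ y₀)) := by
  have h1 : Tendsto (fun n => A n (y n - y₀)) l (𝓝 0) := by
    refine squeeze_zero_norm' (a := fun n => K * ‖y n - y₀‖) ?_ ?_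
    · filter_upwards [hK] with n hn
      exact ((A n).le_opNorm _).trans (by gcongr)
    · have := (tendsto_iff_norm_sub_tendsto_zero.1 hy).const_mul K
      simpa using this
  have h2 := h1.add (hA y₀)
  simpa using h2

end StrongLimits

/-! ### Convergence of eigenvalues for strongly convergent forms -/

section FormOperator

variable {V H : Type*} [NormedAddCommGroup V] [InnerProductSpace ℂ V] [CompleteSpace V]
  [NormedAddCommGroup H] [InnerProductSpace ℂ H] [CompleteSpace H]

/-- The operator on `V` of the form `⟨π q, A (π v)⟩ + ⟨j q, Q (j v)⟩`. -/
def formOp (j π : V →L[ℂ] H) (A Q : H →L[ℂ] H) : V →L[ℂ] V :=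
  π.adjoint ∘L A ∘L π + j.adjoint ∘L Q ∘L j

theorem inner_formOp (j π : V →L[ℂ] H) (A Q : H →L[ℂ] H) (q v : V) :
    inner ℂ q (formOp j π A Q v) = inner ℂ (π q) (A (π v)) + inner ℂ (j q) (Q (j v)) := by
  simp [formOp, ContinuousLinearMap.adjoint_inner_right]

theorem formOp_isSymmetric (j π : V →L[ℂ] H) {A Q : H →L[ℂ] H} (hA : A.IsSymmetric)
    (hQ : Q.IsSymmetric) : (formOp j π A Q).IsSymmetric := by
  intro x y
  change inner ℂ (formOp j π A Q x) y = inner ℂ x (formOp j π A Q y)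
  have h1 : inner ℂ (A (π x)) (π y) = inner ℂ (π x) (A (π y)) := hA _ _
  have h2 : inner ℂ (Q (j x)) (j y) = inner ℂ (j x) (Q (j y)) := hQ _ _
  rw [← inner_conj_symm, inner_formOp, inner_formOp, map_add, inner_conj_symm, inner_conj_symm,
    h1, h2]

end FormOperator

section Convergence

variable {V H : Type*} [NormedAddCommGroup V] [InnerProductSpace ℂ V]
  [NormedAddCommGroup H] [InnerProductSpace ℂ H]

theorem inner_sum_smul_sum_smul (B : V →L[ℂ] V) {ι : Type*} (s : Finset ι) (c : ι → ℂ)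
    (v : ι → V) : inner ℂ (∑ k ∈ s, c k • v k) (B (∑ k ∈ s, c k • v k)) =
      ∑ l ∈ s, ∑ k ∈ s, (starRingEnd ℂ) (c l) * (c k * inner ℂ (v l) (B (v k))) := by
  rw [map_sum, sum_inner]
  refine Finset.sum_congr rfl fun l _ => ?_
  rw [inner_sum]
  refine Finset.sum_congr rfl fun k _ => ?_
  rw [map_smul, inner_smul_left, inner_smul_right]

/-- A quadratic form whose matrix is diagonal. -/
theorem inner_sum_smul_of_diagonal (B : V →L[ℂ] V) {ι : Type*} [Fintype ι] [DecidableEq ι]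
    (c : ι → ℂ) (v : ι → V) (d : ι → ℝ)
    (h : ∀ l k, inner ℂ (v l) (B (v k)) = if l = k then (d k : ℂ) else 0) :
    inner ℂ (∑ k, c k • v k) (B (∑ k, c k • v k)) = ((∑ k, d k * ‖c k‖ ^ 2 : ℝ) : ℂ) := by
  rw [inner_sum_smul_sum_smul, Complex.ofReal_sum]
  refine Finset.sum_congr rfl fun l _ => ?_
  simp only [h, mul_ite, mul_zero]
  rw [Finset.sum_ite_eq, if_pos (Finset.mem_univ _), ← mul_assoc, mul_comm _ (c l), Complex.mul_conj,
    Complex.normSq_eq_norm_sq]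
  push_cast
  ring

theorem linearIndependent_of_inner_eq_ite {ι : Type*} [Fintype ι] [DecidableEq ι] {h : ι → H}
    (R : H →L[ℂ] H) (hR : ∀ l k, inner ℂ (h l) (R (h k)) = if l = k then (1 : ℂ) else 0) :
    LinearIndependent ℂ h := by
  rw [Fintype.linearIndependent_iff]
  intro c hc l
  have : inner ℂ (h l) (R (∑ k, c k • h k)) = c l := by
    rw [map_sum, inner_sum]
    simp [inner_smul_right, hR]
  rw [← this, hc, map_zero, inner_zero_right]

/-- Convergence of the matrices of the forms gives the upper bound for the limit of eigenvalues. -/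
theorem eventually_le_add_of_tendsto [CompleteSpace V] [CompleteSpace H] {j : V →L[ℂ] H} {B : ℕ → V →L[ℂ] V} {B₀ : V →L[ℂ] V}
    {R : ℕ → H →L[ℂ] H} {evn : ℕ → ℕ → ℝ} {ev : ℕ → ℝ}
    (hB : ∀ x y, Tendsto (fun n => inner ℂ x (B n y)) atTop (𝓝 (inner ℂ x (B₀ y))))
    (hR : ∀ h, Tendsto (fun n => R n h) atTop (𝓝 h))
    (hn : ∀ᶠ n in atTop, IsMinMaxSystem j (B n) (R n) (evn n))
    (h₀ : IsMinMaxSystem j B₀ (ContinuousLinearMap.id ℂ H) ev) (m : ℕ) {ε : ℝ} (hε : 0 < ε) :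
    ∀ᶠ n in atTop, evn n m ≤ ev m + ε := by
  obtain ⟨v, hv1, hv2⟩ := h₀.exists_eigenvectors
  set Λ := ev m + ε
  -- A Rayleigh quotient at most `Λ` means that the form of `G n` is nonpositive. On the first `m +
  -- 1` limit eigenvectors the matrix of `G₀` is diagonal with entries at most `-ε`, which leaves
  -- room for a small perturbation.
  let G : ℕ → V →L[ℂ] V := fun n => B n - (Λ : ℂ) • (j.adjoint ∘L R n ∘L j)
  let G₀ : V →L[ℂ] V := B₀ - (Λ : ℂ) • (j.adjoint ∘L j)
  have hGin : ∀ n x y, inner ℂ x (G n y) = inner ℂ x (B n y) - Λ * inner ℂ (j x) (R n (j y)) := by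
    intro n x y
    simp [G, ContinuousLinearMap.adjoint_inner_right]
  have hG₀in : ∀ x y, inner ℂ x (G₀ y) = inner ℂ x (B₀ y) - Λ * inner ℂ (j x) (j y) := by
    intro x y
    simp [G₀, ContinuousLinearMap.adjoint_inner_right]
  have hG : ∀ x y, Tendsto (fun n => inner ℂ x (G n y)) atTop (𝓝 (inner ℂ x (G₀ y))) := by
    intro x y
    simp only [hGin, hG₀in]
    exact (hB x y).sub ((tendsto_const_nhds.inner (hR (j y))).const_mul _)
  -- An entrywise error `δ` costs `δ (∑ ‖c k‖)² ≤ δ (m + 1) ∑ ‖c k‖²`, which is exactly the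
  -- available `ε ∑ ‖c k‖²`.
  set δ := ε / (m + 1) with hδ
  have hδpos : 0 < δ := by positivity
  have hclose : ∀ᶠ n in atTop, ∀ l k : Fin (m + 1),
      ‖inner ℂ (v l) (G n (v k)) - inner ℂ (v l) (G₀ (v k))‖ ≤ δ := by
    rw [eventually_all]
    intro l
    rw [eventually_all]
    intro k
    have := Metric.tendsto_nhds.1 (hG (v l) (v k)) δ hδpos
    filter_upwards [this] with n hn
    rw [← dist_eq_norm]
    exact hn.le
  filter_upwards [hn, hclose] with n hn hclose
  refine hn.le_of_forall m Λ (fun k => v k) ?_ fun c => ?_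
  · refine linearIndependent_of_inner_eq_ite (ContinuousLinearMap.id ℂ H) fun l k => ?_
    rw [hv2]
    simp [Fin.ext_iff]
  · set y := ∑ k : Fin (m + 1), c k • v k with hy
    have h0 : (inner ℂ y (G₀ y)).re ≤ -ε * ∑ k, ‖c k‖ ^ 2 := by
      have := inner_sum_smul_of_diagonal G₀ c (fun k : Fin (m + 1) => v k) (fun k => ev k - Λ)
        (fun l k => by
          have h2 : inner ℂ (j (v l)) (j (v k)) = _ := hv2 l k
          rw [hG₀in, hv1, h2]
          by_cases hlk : l = k
          · simp [hlk]
          · simp [hlk, Fin.ext_iff.not.1 hlk])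
      rw [← hy] at this
      rw [this, Complex.ofReal_re, Finset.mul_sum]
      refine Finset.sum_le_sum fun k _ => ?_
      have hk : ev k ≤ ev m := h₀.mono (Nat.lt_succ_iff.1 k.2)
      gcongr
      simp only [Λ]
      linarith
    have h1 : ‖inner ℂ y ((G n - G₀) y)‖ ≤ δ * (∑ k, ‖c k‖) ^ 2 := by
      rw [hy, inner_sum_smul_sum_smul, sq, Finset.sum_mul_sum, Finset.mul_sum]
      refine (norm_sum_le _ _).trans (Finset.sum_le_sum fun l _ => ?_)
      rw [Finset.mul_sum]
      refine (norm_sum_le _ _).trans (Finset.sum_le_sum fun k _ => ?_)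
      rw [norm_mul, norm_mul, RCLike.norm_conj, sub_apply, inner_sub_right]
      calc ‖c l‖ * (‖c k‖ * _) ≤ ‖c l‖ * (‖c k‖ * δ) := by gcongr; exact hclose l k
        _ = _ := by ring
    have h2 : (∑ k, ‖c k‖) ^ 2 ≤ (m + 1) * ∑ k, ‖c k‖ ^ 2 := by
      have := sq_sum_le_card_mul_sum_sq (s := Finset.univ) (f := fun k : Fin (m + 1) => ‖c k‖)
      simpa using this
    have h3 : δ * (∑ k, ‖c k‖) ^ 2 ≤ ε * ∑ k, ‖c k‖ ^ 2 := by
      calc _ ≤ δ * ((m + 1) * ∑ k, ‖c k‖ ^ 2) := by gcongr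
        _ = _ := by rw [hδ]; field_simp
    have h4 : (inner ℂ y (G n y)).re ≤ 0 := by
      have h5 := (Complex.re_le_norm _).trans h1
      rw [sub_apply, inner_sub_right, Complex.sub_re] at h5
      linarith
    rw [hGin, Complex.sub_re, Complex.re_ofReal_mul] at h4
    linarith

/-- Lower semicontinuity of nonnegative forms under weak convergence of the vectors and strong
convergence of the operators. -/
theorem re_inner_le_of_weak {ι : Type*} {U : Filter ι} [U.NeBot] {A : ι → H →L[ℂ] H}
    {A₀ : H →L[ℂ] H}
    (hsymm : ∀ᶠ n in U, (A n).IsSymmetric) (hpos : ∀ᶠ n in U, ∀ h, 0 ≤ (inner ℂ h (A n h)).re)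
    (hA : ∀ h, Tendsto (fun n => A n h) U (𝓝 (A₀ h))) {x : ι → H} {y : H} {C : ℝ}
    (hx : ∀ᶠ n in U, ‖x n‖ ≤ C)
    (hxy : ∀ q, Tendsto (fun n => inner ℂ (x n) q) U (𝓝 (inner ℂ y q))) {r : ι → ℝ} {r₀ : ℝ}
    (hr : Tendsto r U (𝓝 r₀)) (hle : ∀ᶠ n in U, (inner ℂ (x n) (A n (x n))).re ≤ r n) :
    (inner ℂ y (A₀ y)).re ≤ r₀ := by
  have h1 : Tendsto (fun n => inner ℂ (x n) (A n y)) U (𝓝 (inner ℂ y (A₀ y))) := by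
    have h2 : Tendsto (fun n => inner ℂ (x n) (A n y - A₀ y)) U (𝓝 0) := by
      refine squeeze_zero_norm' (a := fun n => C * ‖A n y - A₀ y‖) ?_ ?_
      · filter_upwards [hx] with n hn
        exact (norm_inner_le_norm _ _).trans (by gcongr)
      · have := (tendsto_iff_norm_sub_tendsto_zero.1 (hA y)).const_mul C
        simpa using this
    have h3 := h2.add (hxy (A₀ y))
    simpa [inner_sub_right] using h3
  have h2 : Tendsto (fun n => inner ℂ y (A n y)) U (𝓝 (inner ℂ y (A₀ y))) :=
    tendsto_const_nhds.inner (hA y)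
  have h1' := (Complex.continuous_re.tendsto _).comp h1
  have h2' := (Complex.continuous_re.tendsto _).comp h2
  have h3 := ((h1'.const_mul 2).sub h2')
  -- Nonnegativity at `x n - y` gives `2 Re⟨x n, A n y⟩ - ⟨y, A n y⟩ ≤ ⟨x n, A n (x n)⟩`. The left
  -- side is affine in `x n` and applies `A n` only to the fixed vector `y`, so weak convergence of
  -- `x n` and strong convergence of `A n` suffice.
  have h4 : 2 * (inner ℂ y (A₀ y)).re - (inner ℂ y (A₀ y)).re ≤ r₀ := by
    refine le_of_tendsto_of_tendsto h3 hr ?_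
    filter_upwards [hsymm, hpos, hle] with n hs hp hl
    have h5 := hp (x n - y)
    have h6 : inner ℂ (A n y) (x n) = inner ℂ y (A n (x n)) := hs y (x n)
    have h7 : (inner ℂ y (A n (x n))).re = (inner ℂ (x n) (A n y)).re := by
      rw [← h6, ← inner_conj_symm, Complex.conj_re]
    rw [map_sub, inner_sub_left, inner_sub_right, inner_sub_right, Complex.sub_re, Complex.sub_re,
      Complex.sub_re, h7] at h5
    simp only [Function.comp_apply]
    linarith
  linarith

/-- Convergence of the eigenvalues of `⟨π q, Aₙ π v⟩ + ⟨j q, Qₙ j v⟩ = λ ⟨j q, Rₙ j v⟩` when `j` is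
compact, the operators are uniformly bounded, `Aₙ` and `Rₙ` uniformly positive, and they converge
strongly. -/
theorem tendsto_eigenvalues [CompleteSpace V] [CompleteSpace H] {j π : V →L[ℂ] H} (hj : IsCompactOperator j)
    (hV : ∀ v, ‖v‖ ^ 2 = ‖j v‖ ^ 2 + ‖π v‖ ^ 2) {A Q R : ℕ → H →L[ℂ] H} {A₀ Q₀ : H →L[ℂ] H} {K α : ℝ}
    (hα : 0 < α)
    (hQK : ∀ᶠ n in atTop, ‖Q n‖ ≤ K) (hRK : ∀ᶠ n in atTop, ‖R n‖ ≤ K)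
    (hAsymm : ∀ᶠ n in atTop, (A n).IsSymmetric)
    (hApos : ∀ᶠ n in atTop, ∀ h, α * ‖h‖ ^ 2 ≤ (inner ℂ h (A n h)).re)
    (hRpos : ∀ᶠ n in atTop, ∀ h, α * ‖h‖ ^ 2 ≤ (inner ℂ h (R n h)).re)
    (hA : ∀ h, Tendsto (fun n => A n h) atTop (𝓝 (A₀ h)))
    (hQ : ∀ h, Tendsto (fun n => Q n h) atTop (𝓝 (Q₀ h)))
    (hR : ∀ h, Tendsto (fun n => R n h) atTop (𝓝 h)) {evn : ℕ → ℕ → ℝ} {ev : ℕ → ℝ}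
    (hn : ∀ᶠ n in atTop, IsMinMaxSystem j (formOp j π (A n) (Q n)) (R n) (evn n))
    (h₀ : IsMinMaxSystem j (formOp j π A₀ Q₀) (ContinuousLinearMap.id ℂ H) ev) (m : ℕ) :
    Tendsto (fun n => evn n m) atTop (𝓝 (ev m)) := by
  classical
  have hup : ∀ ε > 0, ∀ᶠ n in atTop, evn n m ≤ ev m + ε := fun ε hε =>
    eventually_le_add_of_tendsto (fun x y => by
      simp only [inner_formOp]
      exact (tendsto_const_nhds.inner (hA _)).add (tendsto_const_nhds.inner (hQ _))) hR hn h₀ m hε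
  suffices hlow : ∀ ε > 0, ∀ᶠ n in atTop, ev m - ε < evn n m by
    rw [Metric.tendsto_nhds]
    intro ε hε
    filter_upwards [hup (ε / 2) (half_pos hε), hlow (ε / 2) (half_pos hε)] with n h1 h2
    rw [Real.dist_eq, abs_lt]
    constructor <;> linarith
  intro ε hε
  by_contra hcon
  have hfreq : ∃ᶠ n in atTop, evn n m ≤ ev m - ε := by
    refine (not_eventually.1 hcon).mono fun n h => not_lt.1 h
  have hne : (atTop ⊓ 𝓟 {n : ℕ | evn n m ≤ ev m - ε}).NeBot := frequently_iff_neBot.1 hfreq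
  -- The ultrafilter plays the role of a subsequence: it is finer than `atTop`, concentrates on the
  -- bad indices, and all bounded families converge weakly along it at once.
  obtain ⟨U, hU⟩ := Ultrafilter.exists_le (atTop ⊓ 𝓟 {n : ℕ | evn n m ≤ ev m - ε})
  have hUtop : (U : Filter ℕ) ≤ atTop := hU.trans inf_le_left
  have hUle : ∀ᶠ n in (U : Filter ℕ), evn n m ≤ ev m - ε :=
    hU.trans inf_le_right (mem_principal_self _)
  have hnU : ∀ᶠ n in (U : Filter ℕ), IsMinMaxSystem j (formOp j π (A n) (Q n)) (R n) (evn n) :=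
    hUtop hn
  have hex : ∀ n, ∃ v : ℕ → V, IsMinMaxSystem j (formOp j π (A n) (Q n)) (R n) (evn n) →
      (∀ l k, inner ℂ (v l) (formOp j π (A n) (Q n) (v k)) = if l = k then (evn n k : ℂ) else 0) ∧
      ∀ l k, inner ℂ (j (v l)) (R n (j (v k))) = if l = k then (1 : ℂ) else 0 := by
    intro n
    by_cases h : IsMinMaxSystem j (formOp j π (A n) (Q n)) (R n) (evn n)
    · obtain ⟨v, hv⟩ := h.exists_eigenvectors
      exact ⟨v, fun _ => hv⟩
    · exact ⟨0, fun h' => absurd h' h⟩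
  choose v hv using hex
  -- The normalisation by `R n` gives `‖j v‖² ≤ 1 / α`. Then the form value, at most `ev m`, and the
  -- bound `|K| / α` on the `Q n` term control `α ‖π v‖²`.
  set C : ℝ := √(1 / α + (ev m + |K| / α) / α) with hC
  have hbound : ∀ k : Fin (m + 1), ∀ᶠ n in (U : Filter ℕ), ‖v n k‖ ≤ C := by
    intro k
    filter_upwards [hnU, hUle, hUtop hQK, hUtop hApos, hUtop hRpos] with n h1 h2 h3 h4 h5
    obtain ⟨hv1, hv2⟩ := hv n h1
    have hj1 := h5 (j (v n k))
    rw [hv2, if_pos rfl, Complex.one_re] at hj1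
    have hj2 : ‖j (v n k)‖ ^ 2 ≤ 1 / α := by rwa [le_div_iff₀' hα]
    have hq : -(|K| / α) ≤ (inner ℂ (j (v n k)) (Q n (j (v n k)))).re := by
      have : ‖inner ℂ (j (v n k)) (Q n (j (v n k)))‖ ≤ |K| / α := by
        calc _ ≤ ‖j (v n k)‖ * ‖Q n (j (v n k))‖ := norm_inner_le_norm _ _
          _ ≤ ‖j (v n k)‖ * (|K| * ‖j (v n k)‖) := by
              gcongr
              exact ((Q n).le_opNorm _).trans (by gcongr; exact h3.trans (le_abs_self K))
          _ = |K| * ‖j (v n k)‖ ^ 2 := by ring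
          _ ≤ |K| * (1 / α) := by gcongr
          _ = _ := by ring
      exact (abs_le.1 ((Complex.abs_re_le_norm _).trans this)).1
    have he : (inner ℂ (v n k) (formOp j π (A n) (Q n) (v n k))).re = evn n k := by
      rw [hv1, if_pos rfl, Complex.ofReal_re]
    rw [inner_formOp, Complex.add_re] at he
    have hk : evn n k ≤ evn n m := h1.mono (Nat.lt_succ_iff.1 k.2)
    have hp := h4 (π (v n k))
    have hp2 : ‖π (v n k)‖ ^ 2 ≤ (ev m + |K| / α) / α := by
      rw [le_div_iff₀' hα]
      linarith
    refine Real.le_sqrt_of_sq_le ?_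
    rw [hV]
    linarith
  have hw : ∀ k : Fin (m + 1), ∃ w : V, ∀ q,
      Tendsto (fun n => inner ℂ (v n k) q) U (𝓝 (inner ℂ w q)) :=
    fun k => exists_weak_limit U _ (hbound k)
  choose w hw using hw
  have hjw : ∀ k : Fin (m + 1), Tendsto (fun n => j (v n k)) U (𝓝 (j (w k))) :=
    fun k => hj.tendsto_of_weak U _ (hbound k) (hw k)
  have horth : ∀ l k : Fin (m + 1), inner ℂ (j (w l)) (j (w k)) = if l = k then (1 : ℂ) else 0 := by
    intro l k
    have h1 : Tendsto (fun n => inner ℂ (j (v n l)) (R n (j (v n k)))) U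
        (𝓝 (inner ℂ (j (w l)) (j (w k)))) :=
      (hjw l).inner (tendsto_apply_of_strong (A₀ := ContinuousLinearMap.id ℂ H) (hUtop hRK)
        (fun h => (hR h).mono_left hUtop) (hjw k))
    refine tendsto_nhds_unique h1 (tendsto_const_nhds.congr' ?_)
    filter_upwards [hnU] with n h2
    rw [(hv n h2).2]
    simp [Fin.ext_iff]
  -- The weak limits `w k` are competitors in the limit problem, and their span inherits the bound
  -- `ev m - ε` on the Rayleigh quotient.
  have hfinal : ev m ≤ ev m - ε := by
    refine h₀.le_of_forall m _ w
      (linearIndependent_of_inner_eq_ite (ContinuousLinearMap.id ℂ H) horth) fun c => ?_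
    set y := ∑ k, c k • w k with hy
    set yn : ℕ → V := fun n => ∑ k : Fin (m + 1), c k • v n k with hyn
    have hynb : ∀ᶠ n in (U : Filter ℕ), ‖yn n‖ ≤ ∑ k, ‖c k‖ * C := by
      filter_upwards [eventually_all.2 hbound] with n h1
      refine (norm_sum_le _ _).trans (Finset.sum_le_sum fun k _ => ?_)
      rw [norm_smul]
      gcongr
      exact h1 k
    have hyw : ∀ q, Tendsto (fun n => inner ℂ (yn n) q) U (𝓝 (inner ℂ y q)) := by
      intro q
      simp only [hyn, hy, sum_inner, inner_smul_left]
      exact tendsto_finsetSum _ fun k _ => (hw k q).const_mul _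
    have hjy : Tendsto (fun n => j (yn n)) U (𝓝 (j y)) := hj.tendsto_of_weak U _ hynb hyw
    have hQy : Tendsto (fun n => (inner ℂ (j (yn n)) (Q n (j (yn n)))).re) U
        (𝓝 (inner ℂ (j y) (Q₀ (j y))).re) :=
      (Complex.continuous_re.tendsto _).comp
        (hjy.inner (tendsto_apply_of_strong (hUtop hQK) (fun h => (hQ h).mono_left hUtop) hjy))
    have hjyy : (inner ℂ (j y) ((ContinuousLinearMap.id ℂ H) (j y))).re = ∑ k, ‖c k‖ ^ 2 := by
      have h1 := inner_sum_smul_of_diagonal (ContinuousLinearMap.id ℂ H) c (fun k => j (w k))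
        (fun _ => 1) (by simpa using horth)
      rw [hy, map_sum]
      simp only [map_smul] at h1 ⊢
      rw [h1, Complex.ofReal_re]
      simp
    rw [hjyy, inner_formOp, Complex.add_re]
    have hπ : ∀ v, ‖π v‖ ≤ ‖v‖ := fun v => by
      have := hV v
      refine abs_le_of_sq_le_sq' ?_ (norm_nonneg _) |>.2
      nlinarith [sq_nonneg ‖j v‖]
    -- Only the derivative part needs semicontinuity. The `Q n` term, which has no sign, converges
    -- because `j (yn n)` converges strongly, and so it is moved into the right-hand side `r`.
    have hkey := re_inner_le_of_weak (U := (U : Filter ℕ)) (A := A) (A₀ := A₀)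
      (x := fun n => π (yn n)) (y := π y) (hUtop hAsymm)
      (by
        filter_upwards [hUtop hApos] with n h1 h
        exact le_trans (by positivity) (h1 h))
      (fun h => (hA h).mono_left hUtop)
      (by
        filter_upwards [hynb] with n h1
        exact (hπ _).trans h1)
      (fun q => by
        have := hyw (π.adjoint q)
        simpa only [ContinuousLinearMap.adjoint_inner_right] using this)
      (r := fun n => (ev m - ε) * ∑ k, ‖c k‖ ^ 2 - (inner ℂ (j (yn n)) (Q n (j (yn n)))).re)
      (tendsto_const_nhds.sub hQy)
      (by
        filter_upwards [hnU, hUle] with n h1 h2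
        have h3 := inner_sum_smul_of_diagonal (formOp j π (A n) (Q n)) c
          (fun k : Fin (m + 1) => v n k) (fun k => evn n k) (fun l k => by
            rw [(hv n h1).1]
            simp [Fin.ext_iff])
        have h4 := congrArg Complex.re h3
        rw [Complex.ofReal_re, inner_formOp, Complex.add_re] at h4
        have h5 : ∑ k : Fin (m + 1), evn n k * ‖c k‖ ^ 2 ≤ (ev m - ε) * ∑ k, ‖c k‖ ^ 2 := by
          rw [Finset.mul_sum]
          refine Finset.sum_le_sum fun k _ => ?_
          have hk : evn n k ≤ evn n m := h1.mono (Nat.lt_succ_iff.1 k.2)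
          gcongr
          exact hk.trans h2
        simp only [hyn]
        linarith)
    linarith
  linarith

end Convergence

/-! ### Multiplication operators on L² -/

section Multiplication

variable {α : Type*} [MeasurableSpace α] {μ : Measure α}

/-- A real function that is almost everywhere strongly measurable and bounded by `K`. -/
structure IsBddMul (μ : Measure α) (m : α → ℝ) (K : ℝ) : Prop where
  aesm : AEStronglyMeasurable m μ
  bound : ∀ᵐ x ∂μ, |m x| ≤ K

theorem IsBddMul.memLp {m : α → ℝ} {K : ℝ} (h : IsBddMul μ m K) {f : α → ℂ} (hf : MemLp f 2 μ) :
    MemLp (fun x => (m x : ℂ) * f x) 2 μ := by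
  refine hf.of_le_mul (c := K) ?_ ?_
  · exact (Complex.continuous_ofReal.comp_aestronglyMeasurable h.aesm).mul hf.1
  · filter_upwards [h.bound] with x hx
    rw [norm_mul, Complex.norm_real, Real.norm_eq_abs]
    gcongr

theorem L2_norm_sq_eq_integral (f : Lp ℂ 2 μ) : ‖f‖ ^ 2 = ∫ x, ‖f x‖ ^ 2 ∂μ := by
  have h1 : inner ℂ f f = ((‖f‖ ^ 2 : ℝ) : ℂ) := by
    rw [inner_self_eq_norm_sq_to_K]
    norm_cast
  rw [L2.inner_def] at h1
  have h2 : (fun x => inner ℂ (f x) (f x)) = fun x => ((‖f x‖ ^ 2 : ℝ) : ℂ) := by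
    funext x
    rw [inner_self_eq_norm_sq_to_K]
    norm_cast
  rw [h2, integral_complex_ofReal] at h1
  exact_mod_cast h1.symm

theorem L2_integrable_norm_sq (f : Lp ℂ 2 μ) : Integrable (fun x => ‖f x‖ ^ 2) μ :=
  (Lp.memLp f).integrable_norm_pow two_ne_zero

theorem norm_le_mul_norm_of_ae {f g : Lp ℂ 2 μ} {K : ℝ} (h : ∀ᵐ x ∂μ, ‖f x‖ ≤ K * ‖g x‖) :
    ‖f‖ ≤ K * ‖g‖ :=
  Lp.norm_le_mul_norm_of_ae_le_mul h

open Classical in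
/-- Multiplication by a bounded real function on `L²`. -/
def mulOp (μ : Measure α) (m : α → ℝ) : Lp ℂ 2 μ →L[ℂ] Lp ℂ 2 μ :=
  if h : ∃ K, IsBddMul μ m K then
    LinearMap.mkContinuous
      { toFun := fun f => (h.choose_spec.memLp (Lp.memLp f)).toLp
        map_add' := fun f g => by
          ext1
          filter_upwards [MemLp.coeFn_toLp (h.choose_spec.memLp (Lp.memLp (f + g))),
            MemLp.coeFn_toLp (h.choose_spec.memLp (Lp.memLp f)),
            MemLp.coeFn_toLp (h.choose_spec.memLp (Lp.memLp g)),
            Lp.coeFn_add f g, Lp.coeFn_add (h.choose_spec.memLp (Lp.memLp f)).toLp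
              (h.choose_spec.memLp (Lp.memLp g)).toLp] with x h1 h2 h3 h4 h5
          rw [h1, h5, Pi.add_apply, h2, h3, h4, Pi.add_apply, mul_add]
        map_smul' := fun c f => by
          ext1
          filter_upwards [MemLp.coeFn_toLp (h.choose_spec.memLp (Lp.memLp (c • f))),
            MemLp.coeFn_toLp (h.choose_spec.memLp (Lp.memLp f)),
            Lp.coeFn_smul c f, Lp.coeFn_smul c (h.choose_spec.memLp (Lp.memLp f)).toLp]
            with x h1 h2 h3 h4
          rw [RingHom.id_apply, h1, h4, Pi.smul_apply, h2, h3, Pi.smul_apply, smul_eq_mul,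
            smul_eq_mul, mul_left_comm] }
      h.choose
      (fun f => by
        refine norm_le_mul_norm_of_ae ?_
        filter_upwards [MemLp.coeFn_toLp (h.choose_spec.memLp (Lp.memLp f)), h.choose_spec.bound]
          with x h1 h2
        simp only [LinearMap.coe_mk, AddHom.coe_mk]
        rw [h1, norm_mul, Complex.norm_real, Real.norm_eq_abs]
        gcongr)
  -- The default value keeps `mulOp` total, so sequences of multipliers can be written down even at
  -- the index `n = 0`, for which nothing is assumed.
  else 0

variable {m : α → ℝ} {K : ℝ}

theorem IsBddMul.coeFn_mulOp (h : IsBddMul μ m K) (f : Lp ℂ 2 μ) :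
    mulOp μ m f =ᵐ[μ] fun x => (m x : ℂ) * f x := by
  have h' : ∃ K, IsBddMul μ m K := ⟨K, h⟩
  rw [mulOp, dif_pos h']
  exact (h'.choose_spec.memLp (Lp.memLp f)).coeFn_toLp

theorem IsBddMul.norm_mulOp_le (h : IsBddMul μ m K) (hK : 0 ≤ K) : ‖mulOp μ m‖ ≤ K := by
  refine ContinuousLinearMap.opNorm_le_bound _ hK fun f => norm_le_mul_norm_of_ae ?_
  filter_upwards [h.coeFn_mulOp f, h.bound] with x h1 h2
  rw [h1, norm_mul, Complex.norm_real, Real.norm_eq_abs]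
  gcongr

theorem IsBddMul.inner_mulOp (h : IsBddMul μ m K) (f g : Lp ℂ 2 μ) :
    inner ℂ g (mulOp μ m f) = ∫ x, (m x : ℂ) * f x * star (g x) ∂μ := by
  rw [L2.inner_def]
  refine integral_congr_ae ?_
  filter_upwards [h.coeFn_mulOp f] with x hx
  rw [hx, RCLike.inner_apply]
  rfl

theorem IsBddMul.integrable_mul (h : IsBddMul μ m K) (f g : Lp ℂ 2 μ) :
    Integrable (fun x => (m x : ℂ) * f x * star (g x)) μ := by
  refine (L2.integrable_inner (𝕜 := ℂ) g (mulOp μ m f)).congr ?_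
  filter_upwards [h.coeFn_mulOp f] with x hx
  rw [hx, RCLike.inner_apply]
  rfl

theorem IsBddMul.mulOp_isSymmetric (h : IsBddMul μ m K) : (mulOp μ m).IsSymmetric := by
  intro f g
  change inner ℂ (mulOp μ m f) g = inner ℂ f (mulOp μ m g)
  rw [L2.inner_def, L2.inner_def]
  refine integral_congr_ae ?_
  filter_upwards [h.coeFn_mulOp f, h.coeFn_mulOp g] with x hx hy
  rw [hx, hy, RCLike.inner_apply, RCLike.inner_apply, map_mul, Complex.conj_ofReal]
  ring

theorem IsBddMul.le_re_inner_mulOp (h : IsBddMul μ m K) {a : ℝ} (ha : ∀ᵐ x ∂μ, a ≤ m x)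
    (f : Lp ℂ 2 μ) : a * ‖f‖ ^ 2 ≤ (inner ℂ f (mulOp μ m f)).re := by
  have h1 : inner ℂ f (mulOp μ m f) = ((∫ x, m x * ‖f x‖ ^ 2 ∂μ : ℝ) : ℂ) := by
    rw [h.inner_mulOp, ← integral_complex_ofReal]
    refine integral_congr_ae (Eventually.of_forall fun x => ?_)
    simp only
    rw [mul_assoc]
    change _ * (f x * (starRingEnd ℂ) (f x)) = _
    rw [Complex.mul_conj, Complex.normSq_eq_norm_sq]
    push_cast
    ring
  rw [h1, Complex.ofReal_re, L2_norm_sq_eq_integral, ← integral_const_mul]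
  refine integral_mono_ae ((L2_integrable_norm_sq f).const_mul a) ?_ ?_
  · exact (L2_integrable_norm_sq f).bdd_mul h.aesm (c := K) h.bound
  · filter_upwards [ha] with x hx
    gcongr

/-- Bounded almost everywhere convergence of the functions gives strong convergence of the
multiplication operators. -/
theorem tendsto_mulOp {mn : ℕ → α → ℝ} (hn : ∀ᶠ n in atTop, IsBddMul μ (mn n) K)
    (h : IsBddMul μ m K) (hlim : ∀ᵐ x ∂μ, Tendsto (fun n => mn n x) atTop (𝓝 (m x)))
    (f : Lp ℂ 2 μ) : Tendsto (fun n => mulOp μ (mn n) f) atTop (𝓝 (mulOp μ m f)) := by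
  rw [tendsto_iff_norm_sub_tendsto_zero]
  have h1 : ∀ᶠ n in atTop, ∫ x, (mn n x - m x) ^ 2 * ‖f x‖ ^ 2 ∂μ =
      ‖mulOp μ (mn n) f - mulOp μ m f‖ ^ 2 := by
    filter_upwards [hn] with n hn
    rw [L2_norm_sq_eq_integral]
    refine integral_congr_ae ?_
    filter_upwards [hn.coeFn_mulOp f, h.coeFn_mulOp f,
      Lp.coeFn_sub (mulOp μ (mn n) f) (mulOp μ m f)] with x h1 h2 h3
    rw [h3, Pi.sub_apply, h1, h2, ← sub_mul, norm_mul, mul_pow, ← Complex.ofReal_sub,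
      Complex.norm_real, Real.norm_eq_abs, sq_abs]
  -- Dominated convergence for one fixed `f`; the multipliers need not converge uniformly, so only
  -- strong convergence is obtained.
  have h2 : Tendsto (fun n => ∫ x, (mn n x - m x) ^ 2 * ‖f x‖ ^ 2 ∂μ) atTop (𝓝 (∫ _, (0 : ℝ) ∂μ)) := by
    refine tendsto_integral_filter_of_dominated_convergence (fun x => (2 * K) ^ 2 * ‖f x‖ ^ 2)
      ?_ ?_ ((L2_integrable_norm_sq f).const_mul _) ?_
    · filter_upwards [hn] with n hn
      exact ((hn.aesm.sub h.aesm).pow 2).mul (L2_integrable_norm_sq f).1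
    · filter_upwards [hn] with n hn
      filter_upwards [hn.bound, h.bound] with x h1 h2
      rw [Real.norm_eq_abs, abs_of_nonneg (by positivity)]
      gcongr ?_ * _
      rw [sq_le_sq]
      have h3 := abs_le.1 h1
      have h4 := abs_le.1 h2
      rw [abs_le, abs_of_nonneg (a := 2 * K) (by linarith)]
      constructor <;> linarith
    · filter_upwards [hlim] with x hx
      have := ((hx.sub_const (m x)).pow 2).mul_const (‖f x‖ ^ 2)
      simpa using this
  rw [integral_zero] at h2
  have h3 := (h2.congr' h1).sqrt
  simpa using h3

end Multiplication

/-! ### Length measure, comparable weights and form domains on the tree -/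

namespace RadialTree

variable {T : RadialTree}

instance : Countable T.Edge := inferInstanceAs (Countable (Σ j : ℕ, ((i : Fin (j + 1)) → Fin (T.deg i))))

instance : MeasurableSingletonClass T.Edge := ⟨fun _ => trivial⟩

theorem Edge.length_pos (e : T.Edge) : 0 < e.length := T.len_pos e.gen

theorem measurableSet_body : MeasurableSet T.body := by
  have h : Measurable fun x : T.Point => x.1.length :=
    (measurable_from_top (f := fun e : T.Edge => e.length)).comp measurable_fst
  exact (measurableSet_lt measurable_const measurable_snd).inter
    (measurableSet_lt measurable_snd h)

/-- Counting measure is a sum of Dirac masses, so integration over the tree reduces to Lebesgue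
measure on the separate open edges. -/
theorem lengthMeasure_eq_sum : T.lengthMeasure = Measure.sum fun e : T.Edge =>
    (volume.restrict (Set.Ioo 0 e.length)).map (Prod.mk e) := by
  rw [lengthMeasure, Measure.count, Measure.prod_sum_left, Measure.restrict_sum _ measurableSet_body]
  congr 1
  funext e
  rw [Measure.dirac_prod, Measure.restrict_map measurable_prodMk_left measurableSet_body]
  rfl

theorem measurableEmbedding_mk (e : T.Edge) : MeasurableEmbedding (Prod.mk e : ℝ → T.Point) :=
  MeasurableEmbedding.prodMk_left e MeasurableEmbedding.id

theorem ae_lengthMeasure_iff {P : T.Point → Prop} : (∀ᵐ x ∂T.lengthMeasure, P x) ↔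
    ∀ e : T.Edge, ∀ᵐ t ∂volume.restrict (Set.Ioo 0 e.length), P (e, t) := by
  rw [lengthMeasure_eq_sum, Measure.ae_sum_iff]
  exact forall_congr' fun e => (measurableEmbedding_mk e).ae_map_iff

theorem lintegral_lengthMeasure (F : T.Point → ENNReal) : ∫⁻ x, F x ∂T.lengthMeasure =
    ∑' e : T.Edge, ∫⁻ t in Set.Ioo 0 e.length, F (e, t) := by
  rw [lengthMeasure_eq_sum, lintegral_sum_measure]
  exact tsum_congr fun e => (measurableEmbedding_mk e).lintegral_map F

theorem aemeasurable_lengthMeasure {E : Type*} [MeasurableSpace E] {F : T.Point → E}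
    (h : ∀ e : T.Edge, AEMeasurable (fun t => F (e, t)) (volume.restrict (Set.Ioo 0 e.length))) :
    AEMeasurable F T.lengthMeasure := by
  rw [lengthMeasure_eq_sum, aemeasurable_sum_measure_iff]
  exact fun e => (measurableEmbedding_mk e).aemeasurable_map_iff.2 (h e)

theorem ae_mem_body : ∀ᵐ x ∂T.lengthMeasure, x ∈ T.body :=
  ae_restrict_mem measurableSet_body

/-- A measurable weight comparable to the radial weight with values `r j`. -/
structure IsWeight (r : ℕ → ℝ) (c : ℝ) (w : T.Point → ℝ) : Prop where
  measurable : Measurable w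
  lower : ∀ x ∈ T.body, c⁻¹ * r x.1.gen ≤ w x
  upper : ∀ x ∈ T.body, w x ≤ c * r x.1.gen

variable {r : ℕ → ℝ} {c : ℝ} {w w' : T.Point → ℝ}

theorem IsWeight.pos (h : IsWeight r c w) (hr : ∀ j, 0 < r j) (hc : 0 < c) {x : T.Point}
    (hx : x ∈ T.body) : 0 < w x :=
  lt_of_lt_of_le (mul_pos (inv_pos.2 hc) (hr _)) (h.lower x hx)

/-- A weight is positive on the open edges, so null sets do not depend on it; almost everywhere
statements move freely between different weights. -/
theorem IsWeight.ae_weighted (h : IsWeight r c w) (hr : ∀ j, 0 < r j) (hc : 0 < c) :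
    ae (T.weighted w) = ae T.lengthMeasure := by
  refine le_antisymm (withDensity_absolutelyContinuous _ _).ae_le
    (withDensity_absolutelyContinuous' h.measurable.ennreal_ofReal.aemeasurable ?_).ae_le
  filter_upwards [ae_mem_body] with x hx
  rw [Ne, ENNReal.ofReal_eq_zero, not_le]
  exact h.pos hr hc hx

theorem weighted_le_smul {K : ℝ} (hw' : Measurable w') (h : ∀ x ∈ T.body, w x ≤ K * w' x)
    (hK : 0 ≤ K) : T.weighted w ≤ ENNReal.ofReal K • T.weighted w' := by
  rw [weighted, weighted, ← withDensity_smul _ hw'.ennreal_ofReal]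
  refine withDensity_mono ?_
  filter_upwards [ae_mem_body] with x hx
  rw [Pi.smul_apply, smul_eq_mul, ← ENNReal.ofReal_mul hK]
  exact ENNReal.ofReal_le_ofReal (h x hx)

/-- Both weights are compared with the radial one, each at the cost of a factor `c`. -/
theorem IsWeight.le_mul (h : IsWeight r c w) (h' : IsWeight r c w') (hc : 0 < c) {x : T.Point}
    (hx : x ∈ T.body) : w x ≤ c ^ 2 * w' x := by
  have h1 := h.upper x hx
  have h2 := h'.lower x hx
  calc w x ≤ c * r x.1.gen := h1
    _ = c ^ 2 * (c⁻¹ * r x.1.gen) := by field_simp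
    _ ≤ _ := by gcongr

theorem IsWeight.weighted_le (h : IsWeight r c w) (h' : IsWeight r c w') (hc : 0 < c) :
    T.weighted w ≤ ENNReal.ofReal (c ^ 2) • T.weighted w' :=
  weighted_le_smul h'.measurable (fun _ hx => h.le_mul h' hc hx) (by positivity)

theorem integral_weighted (hm : Measurable w) (h0 : ∀ x ∈ T.body, 0 ≤ w x) (F : T.Point → ℂ) :
    ∫ x, F x ∂T.weighted w = ∫ x, F x * (w x : ℂ) ∂T.lengthMeasure := by
  rw [weighted, integral_withDensity_eq_integral_toReal_smul₀ hm.ennreal_ofReal.aemeasurable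
    (Eventually.of_forall fun x => ENNReal.ofReal_lt_top)]
  refine integral_congr_ae ?_
  filter_upwards [ae_mem_body] with x hx
  rw [ENNReal.toReal_ofReal (h0 x hx), Complex.real_smul, mul_comm]

theorem IsC10.differentiableAt {f : T.Point → ℂ} (hf : IsC10 f) (e : T.Edge) {t : ℝ}
    (ht : t ∈ Set.Ioo 0 e.length) : DifferentiableAt ℝ (fun t => f (e, t)) t :=
  ((hf.contDiffOn e).differentiableOn one_ne_zero t (Set.Ioo_subset_Icc_self ht)).differentiableAt
    (Icc_mem_nhds ht.1 ht.2)

theorem IsC10.zero : IsC10 (0 : T.Point → ℂ) :=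
  ⟨⟨fun _ => continuousOn_const, 0, fun _ => ⟨rfl, rfl⟩⟩, fun _ => contDiffOn_const,
    fun _ _ => rfl, 0, fun _ _ _ _ => rfl⟩

theorem IsC10.add {f g : T.Point → ℂ} (hf : IsC10 f) (hg : IsC10 g) : IsC10 (f + g) := by
  obtain ⟨v, hv⟩ := hf.continuous.2
  obtain ⟨u, hu⟩ := hg.continuous.2
  obtain ⟨J, hJ⟩ := hf.compactSupport
  obtain ⟨L, hL⟩ := hg.compactSupport
  refine ⟨⟨fun e => (hf.continuous.1 e).add (hg.continuous.1 e), v + u, fun e => ?_⟩,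
    fun e => (hf.contDiffOn e).add (hg.contDiffOn e), fun e he => ?_, max J L, fun e he t ht => ?_⟩
  · simp [hv e, hu e]
  · simp [hf.root e he, hg.root e he]
  · simp [hJ e ((le_max_left _ _).trans he) t ht, hL e ((le_max_right _ _).trans he) t ht]

theorem IsC10.smul {f : T.Point → ℂ} (hf : IsC10 f) (a : ℂ) : IsC10 (a • f) := by
  obtain ⟨v, hv⟩ := hf.continuous.2
  obtain ⟨J, hJ⟩ := hf.compactSupport
  refine ⟨⟨fun e => (hf.continuous.1 e).const_smul a, a • v, fun e => ?_⟩,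
    fun e => (hf.contDiffOn e).const_smul a, fun e he => ?_, J, fun e he t ht => ?_⟩
  · simp [hv e]
  · simp [hf.root e he]
  · simp [hJ e he t ht]

/-- The pairs `(f, f')` with `f` in `C¹_0`. -/
def core (w : T.Point → ℝ) : Submodule ℂ (T.L2 w × T.L2 w) where
  carrier := {p | ∃ f : T.Point → ℂ, IsC10 f ∧
    p.1 =ᵐ[T.weighted w] f ∧ p.2 =ᵐ[T.weighted w] edgeDeriv f}
  add_mem' := by
    rintro p q ⟨f, hf, hp1, hp2⟩ ⟨g, hg, hq1, hq2⟩
    refine ⟨f + g, hf.add hg, (Lp.coeFn_add _ _).trans (hp1.add hq1),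
      ((Lp.coeFn_add _ _).trans (hp2.add hq2)).trans ?_⟩
    filter_upwards [(withDensity_absolutelyContinuous _ _).ae_le ae_mem_body] with x hx
    exact (deriv_add (hf.differentiableAt x.1 hx) (hg.differentiableAt x.1 hx)).symm
  zero_mem' := ⟨0, IsC10.zero, Lp.coeFn_zero _ _ _, (Lp.coeFn_zero _ _ _).trans
    (Eventually.of_forall fun x => by simp [edgeDeriv])⟩
  smul_mem' := by
    rintro a p ⟨f, hf, hp1, hp2⟩
    refine ⟨a • f, hf.smul a, (Lp.coeFn_smul _ _).trans (hp1.const_smul a),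
      ((Lp.coeFn_smul _ _).trans (hp2.const_smul a)).trans ?_⟩
    filter_upwards [(withDensity_absolutelyContinuous _ _).ae_le ae_mem_body] with x hx
    exact (deriv_const_smul a (hf.differentiableAt x.1 hx)).symm

/-- The space `H¹_{0,w}` with its Hilbert space structure. -/
def formDomain (w : T.Point → ℝ) : Submodule ℂ (WithLp 2 (T.L2 w × T.L2 w)) :=
  -- The product norm used in `H10` is a maximum and carries no inner product. `WithLp 2` has the
  -- same topology, so the closure is unchanged.
  (core w).topologicalClosure.comap
    (WithLp.prodContinuousLinearEquiv 2 ℂ (T.L2 w) (T.L2 w)).toLinearEquiv.toLinearMap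

theorem isClosed_formDomain (w : T.Point → ℝ) :
    IsClosed (formDomain w : Set (WithLp 2 (T.L2 w × T.L2 w))) :=
  (core w).isClosed_topologicalClosure.preimage
    (WithLp.prodContinuousLinearEquiv 2 ℂ (T.L2 w) (T.L2 w)).continuous

instance (w : T.Point → ℝ) : CompleteSpace (formDomain w) :=
  (isClosed_formDomain w).completeSpace_coe

/-- The element of the form domain given by an element of `H¹_{0,w}`. -/
def formDomain.mk {w : T.Point → ℝ} (p : T.L2 w × T.L2 w) (hp : p ∈ H10 w) : formDomain w :=
  ⟨WithLp.toLp 2 p, hp⟩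

/-- The embedding `(u, u') ↦ u`. -/
def valL (w : T.Point → ℝ) : formDomain w →L[ℂ] T.L2 w :=
  WithLp.fstL 2 ℂ (T.L2 w) (T.L2 w) ∘L (formDomain w).subtypeL

/-- The derivative `(u, u') ↦ u'`. -/
def derivL (w : T.Point → ℝ) : formDomain w →L[ℂ] T.L2 w :=
  WithLp.sndL 2 ℂ (T.L2 w) (T.L2 w) ∘L (formDomain w).subtypeL

theorem norm_sq_formDomain (v : formDomain w) : ‖v‖ ^ 2 = ‖valL w v‖ ^ 2 + ‖derivL w v‖ ^ 2 :=
  WithLp.prod_norm_sq_eq_of_L2 (v : WithLp 2 (T.L2 w × T.L2 w))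

theorem valL_derivL_mem_H10 (v : formDomain w) : (valL w v, derivL w v) ∈ H10 w := v.2

section Transfer

/-- The identity from `L²_w` to `L²_{w'}`. -/
def changeWeight {c : ENNReal} (hc : c ≠ ⊤) (h : T.weighted w' ≤ c • T.weighted w) :
    T.L2 w →L[ℂ] T.L2 w' where
  toFun := Lp.LpToLpOfMeasureLeSMul hc h
  map_add' := map_add _
  map_smul' := fun a f => by
    have hac : T.weighted w' ≪ T.weighted w := Measure.absolutelyContinuous_of_le_smul h
    ext1
    filter_upwards [Lp.coeFn_LpToLpOfMeasureLeSMul hc h (a • f),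
      Lp.coeFn_LpToLpOfMeasureLeSMul hc h f, hac.ae_le (Lp.coeFn_smul a f),
      Lp.coeFn_smul a (Lp.LpToLpOfMeasureLeSMul hc h f)] with x h1 h2 h3 h4
    rw [h1, RingHom.id_apply, h4, h3, Pi.smul_apply, Pi.smul_apply, h2]
  cont := (Lp.LpToLpOfMeasureLeSMul hc h).continuous

theorem coeFn_changeWeight {c : ENNReal} (hc : c ≠ ⊤) (h : T.weighted w' ≤ c • T.weighted w)
    (f : T.L2 w) : changeWeight hc h f =ᵐ[T.weighted w'] f :=
  Lp.coeFn_LpToLpOfMeasureLeSMul hc h f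

theorem changeWeight_changeWeight {c c' : ENNReal} (hc : c ≠ ⊤)
    (h : T.weighted w' ≤ c • T.weighted w) (hc' : c' ≠ ⊤) (h' : T.weighted w ≤ c' • T.weighted w')
    (f : T.L2 w) : changeWeight hc' h' (changeWeight hc h f) = f := by
  ext1
  have hac : T.weighted w ≪ T.weighted w' := Measure.absolutelyContinuous_of_le_smul h'
  exact (coeFn_changeWeight hc' h' _).trans (hac.ae_le (coeFn_changeWeight hc h f))

/-- The same `C¹_0` function represents an element of the core for both weights, and a continuous
map sends closure into closure. -/
theorem changeWeight_mem_H10 {c : ENNReal} (hc : c ≠ ⊤) (h : T.weighted w' ≤ c • T.weighted w)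
    {p : T.L2 w × T.L2 w} (hp : p ∈ H10 w) :
    (changeWeight hc h p.1, changeWeight hc h p.2) ∈ H10 w' := by
  have hac : T.weighted w' ≪ T.weighted w := Measure.absolutelyContinuous_of_le_smul h
  refine map_mem_closure (f := fun p : T.L2 w × T.L2 w =>
    (changeWeight hc h p.1, changeWeight hc h p.2)) (by fun_prop) hp ?_
  rintro q ⟨f, hf, h1, h2⟩
  exact ⟨f, hf, (coeFn_changeWeight hc h _).trans (hac.ae_le h1),
    (coeFn_changeWeight hc h _).trans (hac.ae_le h2)⟩

/-- The identity between the form domains of two comparable weights. -/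
def formDomainEquiv {c c' : ENNReal} (hc : c ≠ ⊤) (h : T.weighted w' ≤ c • T.weighted w)
    (hc' : c' ≠ ⊤) (h' : T.weighted w ≤ c' • T.weighted w') :
    formDomain w ≃ₗ[ℂ] formDomain w' where
  toFun v := formDomain.mk _ (changeWeight_mem_H10 hc h (valL_derivL_mem_H10 v))
  map_add' u v := by
    refine Subtype.ext (congrArg (WithLp.toLp 2) ?_)
    simp only [map_add]
    rfl
  map_smul' a v := by
    refine Subtype.ext (congrArg (WithLp.toLp 2) ?_)
    simp only [map_smul]
    rfl
  invFun v := formDomain.mk _ (changeWeight_mem_H10 hc' h' (valL_derivL_mem_H10 v))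
  left_inv v := by
    refine Subtype.ext (congrArg (WithLp.toLp 2) (Prod.ext ?_ ?_))
    · exact changeWeight_changeWeight hc h hc' h' (valL w v)
    · exact changeWeight_changeWeight hc h hc' h' (derivL w v)
  right_inv v := by
    refine Subtype.ext (congrArg (WithLp.toLp 2) (Prod.ext ?_ ?_))
    · exact changeWeight_changeWeight hc' h' hc h (valL w' v)
    · exact changeWeight_changeWeight hc' h' hc h (derivL w' v)

end Transfer

section Energy

/-- The multiplier absorbs a ratio of weights: with `m = ρ₂ / w` this is the inner product of
`L²_{ρ₂}` seen from `L²_w`. -/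
theorem IsBddMul.inner_mulOp_weighted {m : T.Point → ℝ} {K : ℝ} (hm : Measurable w)
    (h0 : ∀ x ∈ T.body, 0 ≤ w x) (h : IsBddMul (T.weighted w) m K) (f g : T.L2 w) :
    inner ℂ g (mulOp (T.weighted w) m f) =
      ∫ x, ((m x * w x : ℝ) : ℂ) * f x * star (g x) ∂T.lengthMeasure := by
  rw [h.inner_mulOp, integral_weighted hm h0]
  refine integral_congr_ae (Eventually.of_forall fun x => ?_)
  simp only
  push_cast
  ring

theorem IsBddMul.integrable_weighted {m : T.Point → ℝ} {K : ℝ} (hm : Measurable w)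
    (h0 : ∀ x ∈ T.body, 0 ≤ w x) (h : IsBddMul (T.weighted w) m K) (f g : T.L2 w) :
    Integrable (fun x => ((m x * w x : ℝ) : ℂ) * f x * star (g x)) T.lengthMeasure := by
  have h1 := h.integrable_mul f g
  change Integrable _ (T.lengthMeasure.withDensity fun x => ENNReal.ofReal (w x)) at h1
  rw [integrable_withDensity_iff_integrable_smul₀' hm.ennreal_ofReal.aemeasurable
    (Eventually.of_forall fun x => ENNReal.ofReal_lt_top)] at h1
  refine h1.congr ?_
  filter_upwards [ae_mem_body] with x hx
  rw [ENNReal.toReal_ofReal (h0 x hx), Complex.real_smul]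
  push_cast
  ring

/-- The energy form in terms of multiplication operators on `L²_w`, for representatives. -/
theorem integral_energy_eq {ρ₁ ρ₂ W m₁ m₂ : T.Point → ℝ} {K₁ K₂ : ℝ} (hm : Measurable w)
    (h0 : ∀ x ∈ T.body, 0 ≤ w x) (h₁ : IsBddMul (T.weighted w) m₁ K₁)
    (h₂ : IsBddMul (T.weighted w) m₂ K₂) (hρ₁ : ∀ x ∈ T.body, ρ₁ x = m₁ x * w x)
    (hρ₂ : ∀ x ∈ T.body, W x * ρ₂ x = m₂ x * w x) (p q : T.L2 w × T.L2 w) :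
    ∫ x, (p.2 x * star (q.2 x) * (ρ₁ x : ℂ) + (W x : ℂ) * p.1 x * star (q.1 x) * (ρ₂ x : ℂ))
      ∂T.lengthMeasure = inner ℂ q.2 (mulOp (T.weighted w) m₁ p.2) +
        inner ℂ q.1 (mulOp (T.weighted w) m₂ p.1) := by
  rw [IsBddMul.inner_mulOp_weighted hm h0 h₁, IsBddMul.inner_mulOp_weighted hm h0 h₂,
    ← integral_add (IsBddMul.integrable_weighted hm h0 h₁ _ _)
      (IsBddMul.integrable_weighted hm h0 h₂ _ _)]
  refine integral_congr_ae ?_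
  filter_upwards [ae_mem_body] with x hx
  rw [← hρ₁ x hx, ← hρ₂ x hx]
  push_cast
  ring

end Energy

end RadialTree

/-! ### The Hardy-type inequality -/

section CauchySchwarz

/-- This is the expansion of `0 ≤ ∫ (m h - I)²`, where `m` is the total mass and `I = ∫ h`. -/
theorem sq_integral_le_measureReal_mul {α : Type*} [MeasurableSpace α] {μ : Measure α}
    [IsFiniteMeasure μ] {h : α → ℝ} (h1 : Integrable h μ) (h2 : Integrable (fun x => h x ^ 2) μ) :
    (∫ x, h x ∂μ) ^ 2 ≤ μ.real Set.univ * ∫ x, h x ^ 2 ∂μ := by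
  rcases eq_or_ne (μ.real Set.univ) 0 with h0 | h0
  · have : μ = 0 := by
      rw [← Measure.measure_univ_eq_zero]
      exact (measureReal_eq_zero_iff).1 h0
    simp [this]
  set m := μ.real Set.univ with hm
  have hmpos : 0 < m := lt_of_le_of_ne measureReal_nonneg (Ne.symm h0)
  set I := ∫ x, h x ∂μ
  have h3 : 0 ≤ ∫ x, (m * h x - I) ^ 2 ∂μ := integral_nonneg fun x => sq_nonneg _
  have h4 : ∫ x, (m * h x - I) ^ 2 ∂μ = m ^ 2 * ∫ x, h x ^ 2 ∂μ - m * I ^ 2 := by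
    have : ∀ x, (m * h x - I) ^ 2 = m ^ 2 * h x ^ 2 - 2 * m * I * h x + I ^ 2 := fun x => by ring
    simp_rw [this]
    rw [integral_add (f := fun x => m ^ 2 * h x ^ 2 - 2 * m * I * h x) (g := fun _ => I ^ 2)
        ((h2.const_mul _).sub (h1.const_mul _)) (integrable_const _),
      integral_sub (h2.const_mul _) (h1.const_mul _), integral_const_mul, integral_const_mul,
      integral_const, smul_eq_mul, ← hm]
    change _ - 2 * m * I * I + _ = _
    ring
  rw [h4] at h3
  have h5 : 0 ≤ m * (m * (∫ x, h x ^ 2 ∂μ) - I ^ 2) := by linarith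
  have := nonneg_of_mul_nonneg_right h5 hmpos
  linarith

end CauchySchwarz

namespace RadialTree

variable {T : RadialTree}

/-- The Dirichlet integral over an edge. -/
def edgeEnergy (f : T.Point → ℂ) (e : T.Edge) : ℝ :=
  ∫ t in Set.Ioo 0 e.length, ‖edgeDeriv f (e, t)‖ ^ 2

theorem edgeEnergy_nonneg (f : T.Point → ℂ) (e : T.Edge) : 0 ≤ edgeEnergy f e :=
  integral_nonneg fun _ => by positivity

theorem IsC10.exists_continuousOn_deriv {f : T.Point → ℂ} (hf : IsC10 f) (e : T.Edge) :
    ∃ g : ℝ → ℂ, ContinuousOn g (Set.Icc 0 e.length) ∧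
      ∀ t ∈ Set.Ioo 0 e.length, edgeDeriv f (e, t) = g t := by
  refine ⟨derivWithin (fun t => f (e, t)) (Set.Icc 0 e.length),
    (hf.contDiffOn e).continuousOn_derivWithin (uniqueDiffOn_Icc e.length_pos) le_rfl, fun t ht => ?_⟩
  exact (derivWithin_of_mem_nhds (Icc_mem_nhds ht.1 ht.2)).symm

theorem IsC10.integrableOn_comp {f : T.Point → ℂ} (hf : IsC10 f) (e : T.Edge) {E : Type*}
    [NormedAddCommGroup E] (φ : ℂ → E) (hφ : Continuous φ) :
    IntegrableOn (fun t => φ (edgeDeriv f (e, t))) (Set.Ioo 0 e.length) := by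
  obtain ⟨g, hg, hfg⟩ := hf.exists_continuousOn_deriv e
  have h1 : IntegrableOn (fun t => φ (g t)) (Set.Ioo 0 e.length) :=
    ((hφ.comp_continuousOn hg).integrableOn_compact isCompact_Icc).mono_set Set.Ioo_subset_Icc_self
  exact h1.congr_fun (fun t ht => by simp only [hfg t ht]) measurableSet_Ioo

/-- The fundamental theorem of calculus and Cauchy–Schwarz. The factor `t - s` yields the edge
length in the Hardy bound and the cell length in the step approximation. -/
theorem IsC10.norm_sub_sq_le {f : T.Point → ℂ} (hf : IsC10 f) (e : T.Edge) {s t : ℝ} (hs : 0 ≤ s)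
    (hst : s ≤ t) (ht : t ≤ e.length) :
    ‖f (e, t) - f (e, s)‖ ^ 2 ≤ (t - s) * edgeEnergy f e := by
  have hsub : Set.Icc s t ⊆ Set.Icc 0 e.length := Set.Icc_subset_Icc hs ht
  have hsub' : Set.Ioo s t ⊆ Set.Ioo 0 e.length := Set.Ioo_subset_Ioo hs ht
  have h1 := intervalIntegral.integral_deriv_of_contDiffOn_Icc ((hf.contDiffOn e).mono hsub) hst
  rw [intervalIntegral.integral_of_le hst, integral_Ioc_eq_integral_Ioo] at h1
  have hn := (hf.integrableOn_comp e (fun z => ‖z‖) continuous_norm).mono_set hsub'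
  have hn2 := hf.integrableOn_comp e (fun z => ‖z‖ ^ 2) (by fun_prop)
  have h2 := sq_integral_le_measureReal_mul hn (hn2.mono_set hsub')
  rw [measureReal_restrict_apply_univ, Real.volume_real_Ioo_of_le hst] at h2
  calc ‖f (e, t) - f (e, s)‖ ^ 2 = ‖∫ x in Set.Ioo s t, edgeDeriv f (e, x)‖ ^ 2 := by
        rw [← h1]; rfl
    _ ≤ (∫ x in Set.Ioo s t, ‖edgeDeriv f (e, x)‖) ^ 2 := by
        gcongr
        exact norm_integral_le_integral_norm _
    _ ≤ (t - s) * ∫ x in Set.Ioo s t, ‖edgeDeriv f (e, x)‖ ^ 2 := h2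
    _ ≤ _ := by
        refine mul_le_mul_of_nonneg_left ?_ (by linarith)
        exact setIntegral_mono_set hn2 (Eventually.of_forall fun _ => by positivity)
          hsub'.eventuallyLE

/-- The labels of the edges of generation `j`. -/
abbrev Word (T : RadialTree) (j : ℕ) : Type := (i : Fin (j + 1)) → Fin (T.deg i)

/-- The edge with a given label. -/
def Word.edge {j : ℕ} (a : T.Word j) : T.Edge := ⟨j, a⟩

/-- Dropping the last letter of a word: each lower end point in generation `j + 1` is the upper end
point of `deg (j + 1)` edges. -/
theorem sum_top_eq (j : ℕ) (h : T.Vertex → ℝ) :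
    ∑ a : T.Word (j + 1), h a.edge.top = T.deg (j + 1) * ∑ b : T.Word j, h b.edge.bot := by
  rw [← (Fin.snocEquiv fun i : Fin (j + 1 + 1) => Fin (T.deg i)).sum_comp, Fintype.sum_prod_type]
  have : ∀ (x : Fin (T.deg (Fin.last (j + 1)))) (b : T.Word j),
      h (Word.edge (T := T) (j := j + 1)
        (Fin.snocEquiv (fun i : Fin (j + 1 + 1) => Fin (T.deg i)) (x, b))).top = h b.edge.bot := by
    intro x b
    congr 1
    refine Sigma.ext rfl (heq_of_eq ?_)
    funext i
    exact Fin.snoc_castSucc (α := fun i : Fin (j + 1 + 1) => Fin (T.deg i)) x b i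
  have h2 : ∀ x : Fin (T.deg (Fin.last (j + 1))), ∑ b : (i : Fin (j + 1)) → Fin (T.deg i.castSucc),
      h (Word.edge (T := T) (j := j + 1)
        (Fin.snocEquiv (fun i : Fin (j + 1 + 1) => Fin (T.deg i)) (x, b))).top =
        ∑ b : T.Word j, h b.edge.bot := fun x => Finset.sum_congr rfl fun b _ => this x b
  rw [Finset.sum_congr rfl fun x _ => h2 x, Finset.sum_const, Finset.card_univ, Fintype.card_fin,
    nsmul_eq_mul]
  rfl

theorem edgeCount_succ (j : ℕ) : (T.edgeCount (j + 1) : ℝ) = T.deg (j + 1) * T.edgeCount j := by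
  have := sum_top_eq (T := T) j fun _ => 1
  simpa [edgeCount] using this

instance (j : ℕ) : Nonempty (T.Word j) := ⟨fun i => ⟨0, T.deg_pos i⟩⟩

theorem edgeCount_pos (j : ℕ) : (0 : ℝ) < T.edgeCount j := by
  have : 0 < Fintype.card (T.Word j) := Fintype.card_pos
  exact_mod_cast this

/-- The square sum of `f` over the points at depth `t` below the vertices of generation `j`. -/
def levelSum (f : T.Point → ℂ) (j : ℕ) (t : ℝ) : ℝ := ∑ a : T.Word j, ‖f (a.edge, t)‖ ^ 2

/-- The Dirichlet integral over the edges of generation `j`. -/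
def levelEnergy (f : T.Point → ℂ) (j : ℕ) : ℝ := ∑ a : T.Word j, edgeEnergy f a.edge

theorem levelEnergy_nonneg (f : T.Point → ℂ) (j : ℕ) : 0 ≤ levelEnergy f j :=
  Finset.sum_nonneg fun _ _ => edgeEnergy_nonneg _ _

/-- The factor `deg (j + 1)` is also the growth of `edgeCount`, so the mean of `‖f‖²` over a
generation does not jump at the vertices. -/
theorem levelSum_succ_zero {f : T.Point → ℂ} (hf : IsContinuous f) (j : ℕ) :
    levelSum f (j + 1) 0 = T.deg (j + 1) * levelSum f j (T.len j) := by
  obtain ⟨val, hval⟩ := hf.2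
  have h1 := sum_top_eq j fun v => ‖val v‖ ^ 2
  simp only [levelSum]
  rw [Finset.sum_congr rfl fun a _ => by rw [(hval a.edge).1], h1]
  congr 1
  refine Finset.sum_congr rfl fun b _ => ?_
  rw [← (hval b.edge).2]
  rfl

/-- The triangle inequality in the Euclidean space indexed by the edges of the generation, with the
increments along single edges as the error. -/
theorem IsC10.sqrt_levelSum_le {f : T.Point → ℂ} (hf : IsC10 f) (j : ℕ) {t : ℝ} (h0 : 0 ≤ t)
    (h1 : t ≤ T.len j) : √(levelSum f j t) ≤
      √(levelSum f j (T.len j)) + √(T.len j * levelEnergy f j) := by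
  let F : ℝ → EuclideanSpace ℂ (T.Word j) := fun t => WithLp.toLp 2 fun a => f (a.edge, t)
  have hF : ∀ t, √(levelSum f j t) = ‖F t‖ := fun t => by
    rw [EuclideanSpace.norm_eq]
    rfl
  have hd : ‖F (T.len j) - F t‖ ≤ √(T.len j * levelEnergy f j) := by
    rw [EuclideanSpace.norm_eq]
    refine Real.sqrt_le_sqrt ?_
    rw [levelEnergy, Finset.mul_sum]
    refine Finset.sum_le_sum fun a _ => ?_
    calc ‖f (a.edge, T.len j) - f (a.edge, t)‖ ^ 2 ≤ (T.len j - t) * edgeEnergy f a.edge :=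
          hf.norm_sub_sq_le a.edge h0 h1 le_rfl
      _ ≤ _ := by
          refine mul_le_mul_of_nonneg_right ?_ (edgeEnergy_nonneg _ _)
          linarith
  rw [hF, hF]
  have := norm_sub_norm_le (F t) (F (T.len j))
  rw [norm_sub_rev] at this
  linarith

/-- The root mean square is followed outwards to generation `N`, where `f` vanishes. Starting from
this end rather than from the root leaves only generations from `j` on in the sum, which makes it
small for large `j`. -/
theorem IsC10.sqrt_mean_le {f : T.Point → ℂ} (hf : IsC10 f) {N : ℕ}
    (hN : levelSum f N 0 = 0) {j : ℕ} (hj : j < N) {t : ℝ} (h0 : 0 ≤ t) (h1 : t ≤ T.len j) :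
    √(levelSum f j t / T.edgeCount j) ≤
      ∑ i ∈ Finset.Ico j N, √(T.len i * levelEnergy f i / T.edgeCount i) := by
  have hstep : ∀ j t, 0 ≤ t → t ≤ T.len j → √(levelSum f j t / T.edgeCount j) ≤
      √(levelSum f (j + 1) 0 / T.edgeCount (j + 1)) +
        √(T.len j * levelEnergy f j / T.edgeCount j) := by
    intro j t h0 h1
    have hd : (0 : ℝ) < T.deg (j + 1) := by exact_mod_cast T.deg_pos (j + 1)
    rw [levelSum_succ_zero hf.continuous, edgeCount_succ, mul_div_mul_left _ _ hd.ne',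
      Real.sqrt_div' _ (edgeCount_pos j).le, Real.sqrt_div' _ (edgeCount_pos j).le,
      Real.sqrt_div' _ (edgeCount_pos j).le, ← add_div]
    exact div_le_div_of_nonneg_right (hf.sqrt_levelSum_le j h0 h1) (Real.sqrt_nonneg _)
  have hroot : ∀ d j, j + d = N → √(levelSum f j 0 / T.edgeCount j) ≤
      ∑ i ∈ Finset.Ico j N, √(T.len i * levelEnergy f i / T.edgeCount i) := by
    intro d
    induction d with
    | zero =>
      rintro j rfl
      rw [add_zero] at hN
      simp [hN]
    | succ d ih =>
      intro j hj
      rw [Finset.sum_eq_sum_Ico_succ_bot (by omega)]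
      have := ih (j + 1) (by omega)
      have h2 := hstep j 0 le_rfl (T.len_pos j).le
      linarith
  rw [Finset.sum_eq_sum_Ico_succ_bot hj]
  have := hroot (N - (j + 1)) (j + 1) (by omega)
  have h2 := hstep j t h0 h1
  linarith

/-- The Hardy-type bound for the part of the tree below generation `j`. -/
theorem IsC10.mul_levelSum_le {f : T.Point → ℂ} (hf : IsC10 f) {N : ℕ}
    (hN : levelSum f N 0 = 0) {r : ℕ → ℝ} (hr : ∀ j, 0 < r j) {C : ℝ} (hC : 0 < C)
    (hgrowth : ∀ i j, i ≤ j → C * ((T.edgeCount i : ℝ) * r i) ≤ (T.edgeCount j : ℝ) * r j)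
    {j : ℕ} (hj : j < N) {t : ℝ} (h0 : 0 ≤ t) (h1 : t ≤ T.len j) :
    r j * levelSum f j t ≤
      (∑ i ∈ Finset.Ico j N, T.len i) / C * ∑ i ∈ Finset.range N, r i * levelEnergy f i := by
  set D := ∑ i ∈ Finset.range N, r i * levelEnergy f i with hD
  have hgpos : ∀ i, 0 < (T.edgeCount i : ℝ) * r i := fun i => mul_pos (edgeCount_pos i) (hr i)
  have h2 := hf.sqrt_mean_le hN hj h0 h1
  -- Cauchy–Schwarz after inserting `r i`: each term factors into `len i / (g i * r i)` and `r i *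
  -- levelEnergy f i`.
  have h3 : ∑ i ∈ Finset.Ico j N, √(T.len i * levelEnergy f i / T.edgeCount i) ≤
      √(∑ i ∈ Finset.Ico j N, T.len i / (T.edgeCount i * r i)) *
        √(∑ i ∈ Finset.Ico j N, r i * levelEnergy f i) := by
    refine le_trans (Finset.sum_le_sum fun i _ => ?_)
      (Real.sum_sqrt_mul_sqrt_le (Finset.Ico j N)
        (fun i => div_nonneg (T.len_pos i).le (hgpos i).le)
        (fun i => mul_nonneg (hr i).le (levelEnergy_nonneg f i)))
    rw [← Real.sqrt_mul (div_nonneg (T.len_pos i).le (hgpos i).le)]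
    refine le_of_eq (congrArg _ ?_)
    have := (hr i).ne'
    have := (edgeCount_pos (T := T) i).ne'
    field_simp
  -- The growth hypothesis bounds every denominator from below by its value at `j`, so only the
  -- remaining height is summed.
  have h4 : ∑ i ∈ Finset.Ico j N, T.len i / (T.edgeCount i * r i) ≤
      (∑ i ∈ Finset.Ico j N, T.len i) / (C * (T.edgeCount j * r j)) := by
    rw [Finset.sum_div]
    refine Finset.sum_le_sum fun i hi => ?_
    have := T.len_pos i
    exact div_le_div_of_nonneg_left this.le (mul_pos hC (hgpos j))
      (hgrowth j i (Finset.mem_Ico.1 hi).1)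
  have h5 : ∑ i ∈ Finset.Ico j N, r i * levelEnergy f i ≤ D := by
    refine Finset.sum_le_sum_of_subset_of_nonneg (fun i hi => ?_) fun i _ _ =>
      mul_nonneg (hr i).le (levelEnergy_nonneg f i)
    exact Finset.mem_range.2 (Finset.mem_Ico.1 hi).2
  set X := (∑ i ∈ Finset.Ico j N, T.len i) / (C * (T.edgeCount j * r j)) with hX
  have hX0 : 0 ≤ X := div_nonneg (Finset.sum_nonneg fun i _ => (T.len_pos i).le)
    (mul_pos hC (hgpos j)).le
  have h6 : √(levelSum f j t / T.edgeCount j) ≤ √(X * D) := by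
    rw [Real.sqrt_mul hX0]
    exact h2.trans (h3.trans (by gcongr))
  have hD0 : 0 ≤ D := Finset.sum_nonneg fun i _ => mul_nonneg (hr i).le (levelEnergy_nonneg f i)
  have h7 : levelSum f j t / T.edgeCount j ≤ X * D := by
    rwa [Real.sqrt_le_sqrt_iff (mul_nonneg hX0 hD0)] at h6
  rw [div_le_iff₀ (edgeCount_pos j)] at h7
  calc r j * levelSum f j t ≤ r j * (X * D * T.edgeCount j) :=
        mul_le_mul_of_nonneg_left h7 (hr j).le
    _ = _ := by
        rw [hX]
        have := (hr j).ne'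
        have := (edgeCount_pos (T := T) j).ne'
        field_simp

/-- The edge lengths of a tree of finite radius are summable. -/
theorem FiniteRadius.summable_len (hR : T.FiniteRadius) : Summable T.len := by
  obtain ⟨R, hR⟩ := hR
  refine summable_of_sum_range_le (c := R) (fun j => (T.len_pos j).le) fun j => ?_
  obtain ⟨a⟩ : Nonempty (T.Word j) := inferInstance
  have h1 : (a.edge, T.len j / 2) ∈ T.body := by
    have := T.len_pos j
    refine ⟨by simp only; linarith, ?_⟩
    change T.len j / 2 < T.len j
    linarith
  have h2 : T.height j + T.len j / 2 ≤ R := hR ⟨_, h1, rfl⟩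
  have := T.len_pos j
  rw [height] at h2
  linarith

end RadialTree

/-! ### Compactness of the embedding by finite-rank approximation -/

section FiniteRank

/-- An operator whose values are approximated, relative to the norm of the argument, by finite
dimensional subspaces is compact. -/
theorem isCompactOperator_of_finiteDimensional_approx {V H : Type*} [NormedAddCommGroup V]
    [NormedSpace ℂ V] [NormedAddCommGroup H] [InnerProductSpace ℂ H] [CompleteSpace H]
    (j : V →L[ℂ] H)
    (h : ∀ ε : ℝ, 0 < ε → ∃ S : Submodule ℂ H, ∃ _ : FiniteDimensional ℂ S,
      ∀ v, ‖j v - S.starProjection (j v)‖ ≤ ε * ‖v‖) : IsCompactOperator j := by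
  choose S hS hSj using fun n : ℕ => h (1 / ((n : ℝ) + 1)) Nat.one_div_pos_of_nat
  refine isCompactOperator_of_tendsto (l := atTop) (F := fun n => (S n).starProjection ∘L j) ?_
    (Eventually.of_forall fun n => ?_)
  · rw [tendsto_iff_norm_sub_tendsto_zero]
    refine squeeze_zero (fun _ => norm_nonneg _) (fun n => ?_) tendsto_one_div_add_atTop_nhds_zero_nat
    refine ContinuousLinearMap.opNorm_le_bound _ Nat.one_div_pos_of_nat.le fun v => ?_
    rw [sub_apply, norm_sub_rev]
    exact hSj n v
  · have hfd := hS n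
    have : LocallyCompactSpace (S n) := by
      have := FiniteDimensional.proper ℂ (S n)
      infer_instance
    have h1 : IsCompactOperator ((S n).orthogonalProjectionOnto ∘L j) :=
      isCompactOperator_of_locallyCompactSpace_dom _
    exact h1.clm_comp (S n).subtypeL

end FiniteRank

namespace RadialTree

variable {T : RadialTree} {r : ℕ → ℝ} {c : ℝ} {w : T.Point → ℝ}

/-- The `k`-th of the `N` cells of equal length in an edge. -/
def cell (e : T.Edge) (N k : ℕ) : Set T.Point :=
  {e} ×ˢ (Set.Ioo 0 e.length ∩ Set.Ico (k * e.length / N) ((k + 1) * e.length / N))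

theorem measurableSet_cell (e : T.Edge) (N k : ℕ) : MeasurableSet (cell e N k) :=
  (measurableSet_singleton e).prod (measurableSet_Ioo.inter measurableSet_Ico)

theorem lintegral_weighted (hm : Measurable w) (F : T.Point → ENNReal) :
    ∫⁻ x, F x ∂T.weighted w = ∑' e : T.Edge, ∫⁻ t in Set.Ioo 0 e.length,
      ENNReal.ofReal (w (e, t)) * F (e, t) := by
  rw [weighted, lintegral_withDensity_eq_lintegral_mul_non_measurable _ hm.ennreal_ofReal
    (Eventually.of_forall fun x => ENNReal.ofReal_lt_top), lintegral_lengthMeasure]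
  rfl

theorem IsWeight.lintegral_edge_lt_top (hw : IsWeight r c w) (e : T.Edge) :
    ∫⁻ t in Set.Ioo 0 e.length, ENNReal.ofReal (w (e, t)) < ⊤ := by
  calc _ ≤ ∫⁻ t in Set.Ioo 0 e.length, ENNReal.ofReal (c * r e.gen) :=
        setLIntegral_mono measurable_const fun t ht => ENNReal.ofReal_le_ofReal (hw.upper (e, t) ht)
    _ < ⊤ := by
        rw [setLIntegral_const, Real.volume_Ioo]
        exact ENNReal.mul_lt_top ENNReal.ofReal_lt_top ENNReal.ofReal_lt_top

theorem IsWeight.weighted_cell_ne_top (hw : IsWeight r c w) (e : T.Edge) (N k : ℕ) :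
    T.weighted w (cell e N k) ≠ ⊤ := by
  rw [← lintegral_indicator_one (measurableSet_cell e N k), lintegral_weighted hw.measurable,
    tsum_eq_single e]
  · refine ne_top_of_le_ne_top (hw.lintegral_edge_lt_top e).ne (lintegral_mono fun t => ?_)
    refine mul_le_of_le_one_right' ?_
    exact Set.indicator_le_self' (fun _ _ => zero_le) _
  · intro e' he'
    have : ∀ t, (cell e N k).indicator (1 : T.Point → ENNReal) (e', t) = 0 := fun t =>
      Set.indicator_of_notMem (fun h => he' h.1) _
    simp [this]

/-- The edges of generation less than `J`, each with `N` cells. -/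
abbrev CellIndex (T : RadialTree) (J N : ℕ) : Type := (Σ j : Fin J, T.Word j) × Fin N

/-- The step functions on the cells of the first `J` generations. -/
def stepMap (hw : IsWeight r c w) (J N : ℕ) : (T.CellIndex J N → ℂ) →ₗ[ℂ] T.L2 w :=
  Fintype.linearCombination ℂ fun i => indicatorConstLp 2 (measurableSet_cell i.1.2.edge N i.2)
    (hw.weighted_cell_ne_top i.1.2.edge N i.2) (1 : ℂ)

theorem coeFn_stepMap (hw : IsWeight r c w) (J N : ℕ) (a : T.CellIndex J N → ℂ) :
    stepMap hw J N a =ᵐ[T.weighted w]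
      fun x => ∑ i, a i * (cell i.1.2.edge N i.2).indicator (fun _ => (1 : ℂ)) x := by
  have h1 : ∀ i : T.CellIndex J N, ∀ᵐ x ∂T.weighted w,
      (a i • indicatorConstLp 2 (measurableSet_cell i.1.2.edge N i.2)
        (hw.weighted_cell_ne_top i.1.2.edge N i.2) (1 : ℂ) : T.L2 w) x =
      a i * (cell i.1.2.edge N i.2).indicator (fun _ => (1 : ℂ)) x := fun i => by
    filter_upwards [Lp.coeFn_smul (a i) (indicatorConstLp 2 (measurableSet_cell i.1.2.edge N i.2)
        (hw.weighted_cell_ne_top i.1.2.edge N i.2) (1 : ℂ)),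
      indicatorConstLp_coeFn (p := 2) (hs := measurableSet_cell i.1.2.edge N i.2)
        (hμs := hw.weighted_cell_ne_top i.1.2.edge N i.2) (c := (1 : ℂ))] with x h2 h3
    rw [h2, Pi.smul_apply, h3, smul_eq_mul]
  rw [stepMap, Fintype.linearCombination_apply]
  filter_upwards [Lp.coeFn_finsetSum Finset.univ fun i : T.CellIndex J N =>
    (a i • indicatorConstLp 2 (measurableSet_cell i.1.2.edge N i.2)
        (hw.weighted_cell_ne_top i.1.2.edge N i.2) (1 : ℂ) : T.L2 w),
    (ae_all_iff.2 h1)] with x h2 h3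
  rw [h2, Finset.sum_apply]
  exact Finset.sum_congr rfl fun i _ => h3 i

/-- Half-open cells partition the open edge, so a rounding determines the cell of a point and the
sum over cells collapses to one term. -/
theorem mem_cell_iff {e e' : T.Edge} {N k : ℕ} (hN : 0 < N) {t : ℝ}
    (ht : t ∈ Set.Ioo 0 e.length) : (e, t) ∈ cell e' N k ↔ e = e' ∧ k = ⌊N * t / e.length⌋₊ := by
  have hl := e.length_pos
  have hN' : (0 : ℝ) < N := by exact_mod_cast hN
  have key : k = ⌊N * t / e.length⌋₊ ↔ k * e.length / N ≤ t ∧ t < (k + 1) * e.length / N := by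
    have h0 : 0 ≤ N * t / e.length := div_nonneg (mul_nonneg hN'.le ht.1.le) hl.le
    rw [eq_comm, Nat.floor_eq_iff h0, le_div_iff₀ hl, div_lt_iff₀ hl, div_le_iff₀ hN',
      lt_div_iff₀ hN', mul_comm t]
  constructor
  · rintro ⟨h1, h2, h3⟩
    obtain rfl : e = e' := h1
    exact ⟨rfl, key.2 h3⟩
  · rintro ⟨rfl, h⟩
    exact ⟨rfl, ht, key.1 h⟩

/-- The step function with the values of `f` at the left end points of the cells. -/
def sample (f : T.Point → ℂ) (J N : ℕ) : T.CellIndex J N → ℂ :=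
  fun i => f (i.1.2.edge, i.2 * i.1.2.edge.length / N)

theorem sum_sample_of_lt (f : T.Point → ℂ) {J N : ℕ} (hN : 0 < N) {j : ℕ} (hj : j < J)
    (a : T.Word j) {t : ℝ} (ht : t ∈ Set.Ioo 0 (T.len j)) :
    ∑ i, sample f J N i * (cell i.1.2.edge N i.2).indicator (fun _ => (1 : ℂ)) (a.edge, t) =
      f (a.edge, ⌊N * t / T.len j⌋₊ * T.len j / N) := by
  have hl := T.len_pos j
  have hN' : (0 : ℝ) < N := by exact_mod_cast hN
  have hlt : ⌊N * t / T.len j⌋₊ < N := by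
    rw [Nat.floor_lt (div_nonneg (mul_nonneg hN'.le ht.1.le) hl.le), div_lt_iff₀ hl]
    exact mul_lt_mul_of_pos_left ht.2 hN'
  rw [Finset.sum_eq_single (⟨⟨⟨j, hj⟩, a⟩, ⟨_, hlt⟩⟩ : T.CellIndex J N)]
  · rw [Set.indicator_of_mem, mul_one]
    · rfl
    · exact (mem_cell_iff hN ht).2 ⟨rfl, rfl⟩
  · rintro ⟨⟨⟨j', hj'⟩, a'⟩, k⟩ - hne
    rw [Set.indicator_of_notMem, mul_zero]
    intro h
    obtain ⟨h1, h2⟩ := (mem_cell_iff hN ht).1 h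
    refine hne ?_
    obtain ⟨h3, h4⟩ := Sigma.mk.inj_iff.1 h1
    obtain rfl : j = j' := h3
    obtain rfl : a = a' := eq_of_heq h4
    congr 1
    exact Fin.ext h2
  · exact fun h => absurd (Finset.mem_univ _) h

theorem sum_sample_of_ge (f : T.Point → ℂ) {J N : ℕ} {j : ℕ} (hj : J ≤ j)
    (a : T.Word j) (t : ℝ) :
    ∑ i, sample f J N i * (cell i.1.2.edge N i.2).indicator (fun _ => (1 : ℂ)) (a.edge, t) = 0 := by
  refine Finset.sum_eq_zero fun i _ => ?_
  rw [Set.indicator_of_notMem, mul_zero]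
  intro h
  have h1 : j = i.1.1 := congrArg Sigma.fst h.1
  have := i.1.1.2
  omega

/-- In extended nonnegative reals the norm splits over generations and edges without any summability
condition. -/
theorem ofReal_norm_sq (hm : Measurable w) (g : T.L2 w) : ENNReal.ofReal (‖g‖ ^ 2) =
    ∑' j : ℕ, ∑ a : T.Word j, ∫⁻ t in Set.Ioo 0 (T.len j),
      ENNReal.ofReal (w (a.edge, t)) * ENNReal.ofReal (‖g (a.edge, t)‖ ^ 2) := by
  rw [L2_norm_sq_eq_integral, ofReal_integral_eq_lintegral_ofReal (L2_integrable_norm_sq g)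
    (Eventually.of_forall fun _ => by positivity), lintegral_weighted hm]
  refine (ENNReal.tsum_sigma (β := fun j : ℕ => T.Word j) fun j a =>
    ∫⁻ t in Set.Ioo 0 (T.len j),
      ENNReal.ofReal (w (Word.edge a, t)) * ENNReal.ofReal (‖g (Word.edge a, t)‖ ^ 2)).trans ?_
  exact tsum_congr fun j => tsum_fintype _

theorem IsWeight.ae_edge (hw : IsWeight r c w) (hr : ∀ j, 0 < r j) (hc : 0 < c)
    {P : T.Point → Prop} (h : ∀ᵐ x ∂T.weighted w, P x) {j : ℕ} (a : T.Word j) :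
    ∀ᵐ t ∂volume.restrict (Set.Ioo 0 (T.len j)), P (a.edge, t) := by
  rw [hw.ae_weighted hr hc] at h
  exact ae_lengthMeasure_iff.1 h a.edge

/-- The Dirichlet integral of `f` is controlled by the norm in `L²_w`. -/
theorem IsWeight.sum_levelEnergy_le (hw : IsWeight r c w) (hr : ∀ j, 0 < r j) (hc : 0 < c)
    {f : T.Point → ℂ} (hf : IsC10 f) {g : T.L2 w} (hg : g =ᵐ[T.weighted w] edgeDeriv f) (N : ℕ) :
    ∑ i ∈ Finset.range N, r i * levelEnergy f i ≤ c * ‖g‖ ^ 2 := by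
  rw [← ENNReal.ofReal_le_ofReal_iff (by positivity), ENNReal.ofReal_mul hc.le,
    ofReal_norm_sq hw.measurable, ENNReal.ofReal_sum_of_nonneg
      fun i _ => mul_nonneg (hr i).le (levelEnergy_nonneg f i), ← ENNReal.tsum_mul_left]
  refine le_trans (Finset.sum_le_sum fun j _ => ?_) (ENNReal.sum_le_tsum (Finset.range N))
  rw [levelEnergy, Finset.mul_sum, Finset.mul_sum, ENNReal.ofReal_sum_of_nonneg
    fun a _ => mul_nonneg (hr j).le (edgeEnergy_nonneg f _)]
  refine Finset.sum_le_sum fun a _ => ?_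
  rw [edgeEnergy, ENNReal.ofReal_mul (hr j).le, ofReal_integral_eq_lintegral_ofReal
    (hf.integrableOn_comp a.edge (fun z => ‖z‖ ^ 2) (by fun_prop))
    (Eventually.of_forall fun _ => by positivity), ← lintegral_const_mul' _ _ ENNReal.ofReal_ne_top,
    ← lintegral_const_mul' _ _ ENNReal.ofReal_ne_top]
  refine lintegral_mono_ae ?_
  filter_upwards [hw.ae_edge hr hc hg a, ae_restrict_mem measurableSet_Ioo] with t h1 ht
  rw [h1, ← mul_assoc, ← ENNReal.ofReal_mul hc.le]
  gcongr
  have := hw.lower (a.edge, t) ht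
  calc r j = c * (c⁻¹ * r j) := by field_simp
    _ ≤ _ := by
        gcongr
        exact this

/-- Uniform approximation of the elements of the core by step functions. -/
theorem IsWeight.norm_sub_stepMap_sq_le (hw : IsWeight r c w) (hr : ∀ j, 0 < r j) (hc : 0 < c)
    {C : ℝ} (hC : 0 < C)
    (hgrowth : ∀ i j, i ≤ j → C * ((T.edgeCount i : ℝ) * r i) ≤ (T.edgeCount j : ℝ) * r j)
    (hsum : Summable T.len) {η : ℝ} (hη : 0 < η) {J N : ℕ} (hN : 0 < N)
    (hlen : ∀ j < J, T.len j / N ≤ η)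
    (htail : ∀ j L, J ≤ j → ∑ i ∈ Finset.Ico j L, T.len i ≤ η * C)
    {f : T.Point → ℂ} (hf : IsC10 f) {u u' : T.L2 w} (hu : u =ᵐ[T.weighted w] f)
    (hu' : u' =ᵐ[T.weighted w] edgeDeriv f) :
    ‖u - stepMap hw J N (sample f J N)‖ ^ 2 ≤ c ^ 2 * η * (∑' j, T.len j) * ‖u'‖ ^ 2 := by
  obtain ⟨L₀, hL₀⟩ := hf.compactSupport
  -- `f` vanishes from generation `L` on, and the energies of all generations below `J` are included
  -- in `D`.
  set L := max L₀ J with hL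
  set D := ∑ i ∈ Finset.range L, r i * levelEnergy f i with hD
  have hD0 : 0 ≤ D := Finset.sum_nonneg fun i _ => mul_nonneg (hr i).le (levelEnergy_nonneg f i)
  have hzero : ∀ j, L₀ ≤ j → ∀ t ∈ Set.Icc 0 (T.len j), levelSum f j t = 0 := fun j hj t ht =>
    Finset.sum_eq_zero fun a _ => by rw [hL₀ a.edge hj t ht]; simp
  -- For `j < J` the error is small because the cells are short. For `j ≥ J` the step function is
  -- zero and the Hardy bound makes `f` itself small. Being uniform in `t`, the bound integrates to
  -- a factor `len j`, which is summable.
  have hlevel : ∀ j, ∀ t ∈ Set.Ioo 0 (T.len j), r j * ∑ a : T.Word j, ‖f (a.edge, t) -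
      ∑ i, sample f J N i * (cell i.1.2.edge N i.2).indicator (fun _ => (1 : ℂ)) (a.edge, t)‖ ^ 2 ≤
        η * D := by
    intro j t ht
    have hlj := T.len_pos j
    have hN' : (0 : ℝ) < N := by exact_mod_cast hN
    rcases lt_or_ge j J with hj | hj
    · have h1 : ∀ a : T.Word j, ‖f (a.edge, t) - ∑ i, sample f J N i *
          (cell i.1.2.edge N i.2).indicator (fun _ => (1 : ℂ)) (a.edge, t)‖ ^ 2 ≤
          T.len j / N * edgeEnergy f a.edge := by
        intro a
        rw [sum_sample_of_lt f hN hj a ht]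
        have hfl := (mem_cell_iff (e := a.edge) (e' := a.edge) hN ht).2 ⟨rfl, rfl⟩
        have h2 : (⌊N * t / T.len j⌋₊ : ℝ) * T.len j / N ≤ t := hfl.2.2.1
        have h3 : t < (⌊N * t / T.len j⌋₊ + 1) * T.len j / N := hfl.2.2.2
        refine (hf.norm_sub_sq_le a.edge (by positivity) h2 ht.2.le).trans ?_
        refine mul_le_mul_of_nonneg_right ?_ (edgeEnergy_nonneg _ _)
        have : ((⌊N * t / T.len j⌋₊ : ℝ) + 1) * T.len j / N =
          ⌊N * t / T.len j⌋₊ * T.len j / N + T.len j / N := by ring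
        linarith
      calc _ ≤ r j * ∑ a : T.Word j, T.len j / N * edgeEnergy f a.edge :=
            mul_le_mul_of_nonneg_left (Finset.sum_le_sum fun a _ => h1 a) (hr j).le
        _ = T.len j / N * (r j * levelEnergy f j) := by
            rw [← Finset.mul_sum, levelEnergy]
            ring
        _ ≤ η * D := by
            refine mul_le_mul (hlen j hj) ?_ (mul_nonneg (hr j).le (levelEnergy_nonneg f j)) hη.le
            exact Finset.single_le_sum (f := fun i => r i * levelEnergy f i)
              (fun i _ => mul_nonneg (hr i).le (levelEnergy_nonneg f i))
              (Finset.mem_range.2 (hj.trans_le (le_max_right _ _)))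
    · simp only [sum_sample_of_ge f hj, sub_zero]
      change r j * levelSum f j t ≤ _
      rcases lt_or_ge j L with hjL | hjL
      · refine (hf.mul_levelSum_le (hzero L (le_max_left _ _) 0 ⟨le_rfl, (T.len_pos L).le⟩) hr hC
          hgrowth hjL ht.1.le ht.2.le).trans ?_
        refine mul_le_mul_of_nonneg_right ?_ hD0
        rw [div_le_iff₀ hC]
        exact htail j L hj
      · rw [hzero j ((le_max_left _ _).trans hjL) t (Set.Ioo_subset_Icc_self ht), mul_zero]
        positivity
  set s := stepMap hw J N (sample f J N) with hs
  have hae : ∀ᵐ x ∂T.weighted w, (u - s) x = f x -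
      ∑ i, sample f J N i * (cell i.1.2.edge N i.2).indicator (fun _ => (1 : ℂ)) x := by
    filter_upwards [Lp.coeFn_sub u s, hu, coeFn_stepMap hw J N (sample f J N)] with x h1 h2 h3
    rw [h1, Pi.sub_apply, h2, h3]
  have hS0 : 0 ≤ ∑' j, T.len j := tsum_nonneg fun j => (T.len_pos j).le
  have hmain : ‖u - s‖ ^ 2 ≤ c * (η * D) * ∑' j, T.len j := by
    rw [← ENNReal.ofReal_le_ofReal_iff (by positivity), ofReal_norm_sq hw.measurable,
      ENNReal.ofReal_mul (by positivity), ENNReal.ofReal_tsum_of_nonneg (fun j => (T.len_pos j).le)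
      hsum, ← ENNReal.tsum_mul_left]
    refine ENNReal.tsum_le_tsum fun j => ?_
    have hmeas : ∀ a ∈ (Finset.univ : Finset (T.Word j)), AEMeasurable (fun t =>
        ENNReal.ofReal (w (a.edge, t)) * ENNReal.ofReal (‖(u - s) (a.edge, t)‖ ^ 2))
        (volume.restrict (Set.Ioo 0 (T.len j))) := by
      intro a _
      refine AEMeasurable.mul
        (hw.measurable.comp measurable_prodMk_left).ennreal_ofReal.aemeasurable ?_
      have h1 := (Lp.stronglyMeasurable (u - s)).measurable.comp
        (measurable_prodMk_left (x := (a.edge : T.Edge)))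
      exact (h1.norm.pow_const 2).ennreal_ofReal.aemeasurable
    rw [← lintegral_finsetSum' _ hmeas]
    calc _ ≤ ∫⁻ _ in Set.Ioo 0 (T.len j), ENNReal.ofReal (c * (η * D)) := by
          refine lintegral_mono_ae ?_
          filter_upwards [ae_all_iff.2 fun a : T.Word j => hw.ae_edge hr hc hae a,
            ae_restrict_mem measurableSet_Ioo] with t h1 ht
          calc _ ≤ ∑ a : T.Word j, ENNReal.ofReal (c * (r j * ‖f (a.edge, t) -
                ∑ i, sample f J N i *
                  (cell i.1.2.edge N i.2).indicator (fun _ => (1 : ℂ)) (a.edge, t)‖ ^ 2)) := by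
                refine Finset.sum_le_sum fun a _ => ?_
                rw [h1 a, ← ENNReal.ofReal_mul' (by positivity), ← mul_assoc]
                refine ENNReal.ofReal_le_ofReal (mul_le_mul_of_nonneg_right ?_ (by positivity))
                exact hw.upper (a.edge, t) ht
            _ = ENNReal.ofReal (c * (r j * ∑ a : T.Word j, ‖f (a.edge, t) -
                ∑ i, sample f J N i *
                  (cell i.1.2.edge N i.2).indicator (fun _ => (1 : ℂ)) (a.edge, t)‖ ^ 2)) := by
                rw [Finset.mul_sum, Finset.mul_sum, ENNReal.ofReal_sum_of_nonneg]
                intro a _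
                have := hr j
                positivity
            _ ≤ _ := ENNReal.ofReal_le_ofReal (mul_le_mul_of_nonneg_left (hlevel j t ht) hc.le)
      _ = _ := by
          rw [setLIntegral_const, Real.volume_Ioo, sub_zero]
  have hDle := hw.sum_levelEnergy_le hr hc hf hu' L
  calc _ ≤ c * (η * D) * ∑' j, T.len j := hmain
    _ ≤ c * (η * (c * ‖u'‖ ^ 2)) * ∑' j, T.len j := by gcongr
    _ = _ := by ring

/-- The embedding of `H¹_{0,w}` into `L²_w` is compact. -/
theorem IsWeight.isCompactOperator_valL (hw : IsWeight r c w) (hr : ∀ j, 0 < r j) (hc : 0 < c)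
    {C : ℝ} (hC : 0 < C)
    (hgrowth : ∀ i j, i ≤ j → C * ((T.edgeCount i : ℝ) * r i) ≤ (T.edgeCount j : ℝ) * r j)
    (hsum : Summable T.len) : IsCompactOperator (valL w) := by
  refine isCompactOperator_of_finiteDimensional_approx _ fun ε hε => ?_
  have hS0 : 0 ≤ ∑' j, T.len j := tsum_nonneg fun j => (T.len_pos j).le
  -- With `η = ε² / A` the error `c² η ∑ len` is at most `ε²`; the added `1` makes `A` visibly
  -- positive.
  set A := c ^ 2 * (∑' j, T.len j) + 1 with hA
  have hApos : 0 < A := by positivity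
  set η := ε ^ 2 / A with hη
  have hηpos : 0 < η := by positivity
  obtain ⟨J, hJ⟩ : ∃ J, ∑' i, T.len (i + J) < η * C := by
    have := (tendsto_sum_nat_add T.len).eventually (gt_mem_nhds (mul_pos hηpos hC))
    exact this.exists
  have htail : ∀ j L, J ≤ j → ∑ i ∈ Finset.Ico j L, T.len i ≤ η * C := by
    intro j L hj
    refine le_trans ?_ hJ.le
    calc _ ≤ ∑ i ∈ Finset.Ico J L, T.len i :=
          Finset.sum_le_sum_of_subset_of_nonneg (Finset.Ico_subset_Ico_left hj)
            fun i _ _ => (T.len_pos i).le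
      _ = ∑ i ∈ Finset.range (L - J), T.len (i + J) := by
          rw [Finset.sum_Ico_eq_sum_range]
          exact Finset.sum_congr rfl fun i _ => by rw [add_comm]
      _ ≤ _ := ((summable_nat_add_iff J).2 hsum).sum_le_tsum _ fun i _ => (T.len_pos _).le
  obtain ⟨N, hN0, hN⟩ : ∃ N : ℕ, 0 < N ∧ (∑' j, T.len j) / N ≤ η := by
    obtain ⟨N, hN⟩ := exists_nat_gt ((∑' j, T.len j) / η)
    have hN0 : (0 : ℝ) < N := lt_of_le_of_lt (by positivity) hN
    refine ⟨N, by exact_mod_cast hN0, ?_⟩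
    rw [div_le_iff₀ hN0]
    rw [div_lt_iff₀ hηpos] at hN
    linarith
  have hlen : ∀ j < J, T.len j / N ≤ η := fun j _ => by
    refine le_trans ?_ hN
    gcongr
    exact hsum.le_tsum j fun i _ => (T.len_pos i).le
  let S : Submodule ℂ (T.L2 w) := LinearMap.range (stepMap hw J N)
  have hfd : FiniteDimensional ℂ S := inferInstance
  refine ⟨S, hfd, fun v => ?_⟩
  have hcore : ∀ p ∈ core w, ‖p.1 - S.starProjection p.1‖ ≤ ε * ‖p.2‖ := by
    rintro p ⟨f, hf, h1, h2⟩
    have h3 := hw.norm_sub_stepMap_sq_le hr hc hC hgrowth hsum hηpos hN0 hlen htail hf h1 h2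
    have h4 : ‖p.1 - S.starProjection p.1‖ ≤ ‖p.1 - stepMap hw J N (sample f J N)‖ := by
      rw [Submodule.starProjection_minimal]
      exact ciInf_le ⟨0, by rintro _ ⟨x, rfl⟩; exact norm_nonneg _⟩
        (⟨stepMap hw J N (sample f J N), LinearMap.mem_range_self _ _⟩ : S)
    refine h4.trans (abs_le_of_sq_le_sq' ?_ (by positivity)).2
    calc _ ≤ c ^ 2 * η * (∑' j, T.len j) * ‖p.2‖ ^ 2 := h3
      _ = η * (c ^ 2 * ∑' j, T.len j) * ‖p.2‖ ^ 2 := by ring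
      _ ≤ η * A * ‖p.2‖ ^ 2 := by
          gcongr
          linarith
      _ = (ε * ‖p.2‖) ^ 2 := by
          rw [hη]
          field_simp
  -- The estimate is a closed condition on the pair, so it passes from `C¹_0` to its completion.
  have hcl : ∀ p ∈ H10 w, ‖p.1 - S.starProjection p.1‖ ≤ ε * ‖p.2‖ := by
    have hclosed : IsClosed {p : T.L2 w × T.L2 w | ‖p.1 - S.starProjection p.1‖ ≤ ε * ‖p.2‖} :=
      isClosed_le (by fun_prop) (by fun_prop)
    exact fun p hp => (closure_minimal (s := (core w : Set (T.L2 w × T.L2 w))) hcore hclosed) hp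
  refine (hcl _ (valL_derivL_mem_H10 v)).trans ?_
  gcongr
  have := norm_sq_formDomain v
  refine (abs_le_of_sq_le_sq' ?_ (norm_nonneg _)).2
  nlinarith [sq_nonneg ‖valL w v‖]

end RadialTree

/-! ### Infinite dimension of L² and density of the form domain -/

namespace RadialTree

variable {T : RadialTree} {r : ℕ → ℝ} {c : ℝ} {w : T.Point → ℝ}

theorem mem_cell_one_zero_iff {e e' : T.Edge} {t : ℝ} :
    (e, t) ∈ cell e' 1 0 ↔ e = e' ∧ t ∈ Set.Ioo 0 e.length := by
  constructor
  · rintro ⟨h1, h2, -⟩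
    obtain rfl : e = e' := h1
    exact ⟨rfl, h2⟩
  · rintro ⟨rfl, h⟩
    exact ⟨rfl, h, by simpa using ⟨h.1.le, h.2⟩⟩

/-- The indicator function of an open edge, as an element of `L²_w`. -/
def edgeIndicator (hw : IsWeight r c w) (e : T.Edge) : T.L2 w :=
  indicatorConstLp 2 (measurableSet_cell e 1 0) (hw.weighted_cell_ne_top e 1 0) (1 : ℂ)

theorem coeFn_edgeIndicator (hw : IsWeight r c w) (e : T.Edge) :
    edgeIndicator hw e =ᵐ[T.weighted w] (cell e 1 0).indicator fun _ => (1 : ℂ) :=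
  indicatorConstLp_coeFn

/-- Indicators of distinct edges are nonzero and orthogonal, and every generation has an edge.
Infinite dimension allows the eigenvalues to be indexed by all of `ℕ`. -/
theorem not_finiteDimensional_L2 (hw : IsWeight r c w) (hr : ∀ j, 0 < r j) (hc : 0 < c) :
    ¬ FiniteDimensional ℂ (T.L2 w) := by
  intro hfd
  have hne : ∀ e : T.Edge, edgeIndicator hw e ≠ 0 := by
    intro e h0
    have h1 := coeFn_edgeIndicator hw e
    rw [h0] at h1
    have h2 : ∀ᵐ x ∂T.weighted w, (cell e 1 0).indicator (fun _ => (1 : ℂ)) x = 0 := by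
      filter_upwards [h1, Lp.coeFn_zero ℂ 2 (T.weighted w)] with x h3 h4
      rw [← h3, h4, Pi.zero_apply]
    rw [hw.ae_weighted hr hc, ae_lengthMeasure_iff] at h2
    have h3 : ∀ᵐ t ∂volume.restrict (Set.Ioo 0 e.length), False := by
      filter_upwards [h2 e, ae_restrict_mem measurableSet_Ioo] with t h4 ht
      rw [Set.indicator_of_mem (mem_cell_one_zero_iff.2 ⟨rfl, ht⟩)] at h4
      exact one_ne_zero h4
    rw [eventually_false_iff_eq_bot, ae_eq_bot, Measure.restrict_eq_zero, Real.volume_Ioo,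
      ENNReal.ofReal_eq_zero] at h3
    linarith [e.length_pos]
  have horth : ∀ e e' : T.Edge, e ≠ e' → inner ℂ (edgeIndicator hw e) (edgeIndicator hw e') = 0 := by
    intro e e' hee
    rw [L2.inner_def]
    refine integral_eq_zero_of_ae ?_
    filter_upwards [coeFn_edgeIndicator hw e, coeFn_edgeIndicator hw e'] with x h1 h2
    rw [h1, h2, Pi.zero_apply]
    by_cases hx : x ∈ cell e 1 0
    · have hx' : x ∉ cell e' 1 0 := fun h => hee (hx.1.symm.trans h.1)
      rw [Set.indicator_of_notMem hx', inner_zero_right]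
    · rw [Set.indicator_of_notMem hx, inner_zero_left]
  have hli : LinearIndependent ℂ (edgeIndicator hw) :=
    linearIndependent_of_ne_zero_of_inner_eq_zero hne horth
  have hinf : Infinite T.Edge := by
    refine Infinite.of_injective (fun j : ℕ => (Classical.arbitrary (T.Word j)).edge) ?_
    intro i j hij
    exact congrArg Sigma.fst hij
  have := hli.finite
  exact not_finite T.Edge

open Classical in
/-- The function equal to `g` on the edge `e` and zero elsewhere. -/
def bump (e : T.Edge) (g : ℝ → ℝ) : T.Point → ℂ := fun x => if x.1 = e then (g x.2 : ℂ) else 0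

theorem bump_self (e : T.Edge) (g : ℝ → ℝ) (t : ℝ) : bump e g (e, t) = g t := if_pos rfl

theorem bump_of_ne {e e' : T.Edge} (h : e' ≠ e) (g : ℝ → ℝ) (t : ℝ) : bump e g (e', t) = 0 :=
  if_neg h

theorem edgeDeriv_bump (e : T.Edge) {g : ℝ → ℝ} (hg : ContDiff ℝ ∞ g) :
    edgeDeriv (bump e g) = bump e (deriv g) := by
  funext ⟨e', t⟩
  by_cases h : e' = e
  · subst h
    simp only [edgeDeriv, bump_self]
    exact ((hg.differentiable (by simp) t).hasDerivAt.ofReal_comp).deriv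
  · simp only [edgeDeriv, bump_of_ne h]
    exact deriv_const _ _

/-- Support inside an open edge makes the vertex and root conditions automatic. -/
theorem isC10_bump (e : T.Edge) {g : ℝ → ℝ} (hg : ContDiff ℝ ∞ g)
    (hsupp : tsupport g ⊆ Set.Ioo 0 e.length) : IsC10 (bump e g) := by
  have h0 : g 0 = 0 := image_eq_zero_of_notMem_tsupport fun h => lt_irrefl _ (hsupp h).1
  have h1 : g e.length = 0 := image_eq_zero_of_notMem_tsupport fun h => lt_irrefl _ (hsupp h).2
  have hc : ∀ e' : T.Edge, ContDiff ℝ 1 fun t => bump e g (e', t) := by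
    intro e'
    by_cases h : e' = e
    · subst h
      simp only [bump_self]
      exact Complex.ofRealCLM.contDiff.comp (hg.of_le (by simp))
    · simp only [bump_of_ne h]
      exact contDiff_const
  have hz : ∀ e' : T.Edge, bump e g (e', 0) = 0 := by
    intro e'
    by_cases h : e' = e
    · subst h
      rw [bump_self, h0, Complex.ofReal_zero]
    · rw [bump_of_ne h]
  refine ⟨⟨fun e' => (hc e').continuous.continuousOn, 0, fun e' => ⟨hz e', ?_⟩⟩,
    fun e' => (hc e').contDiffOn, fun e' _ => hz e', e.gen + 1, fun e' he' t _ => ?_⟩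
  · by_cases h : e' = e
    · subst h
      rw [bump_self, h1, Complex.ofReal_zero]
      rfl
    · rw [bump_of_ne h]
      rfl
  · refine bump_of_ne ?_ _ _
    rintro rfl
    omega

theorem memLp_bump (hw : IsWeight r c w) (e : T.Edge) {g : ℝ → ℝ} (hg : Continuous g)
    (hsupp : tsupport g ⊆ Set.Ioo 0 e.length) (hcomp : HasCompactSupport g) :
    MemLp (bump e g) 2 (T.weighted w) := by
  obtain ⟨K, hK⟩ := hcomp.exists_bound_of_continuous hg
  have hmeas : Measurable (bump e g) :=
    Measurable.ite (measurable_fst (measurableSet_singleton e))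
      (Complex.measurable_ofReal.comp (hg.measurable.comp measurable_snd)) measurable_const
  refine (memLp_indicator_const 2 (measurableSet_cell e 1 0) (1 : ℂ)
    (Or.inr (hw.weighted_cell_ne_top e 1 0))).of_le_mul (c := K) hmeas.aestronglyMeasurable
    (Eventually.of_forall fun ⟨e', t⟩ => ?_)
  by_cases h : e' = e
  · subst h
    rw [bump_self, Complex.norm_real]
    by_cases ht : t ∈ Set.Ioo 0 e'.length
    · rw [Set.indicator_of_mem (mem_cell_one_zero_iff.2 ⟨rfl, ht⟩), norm_one, mul_one]
      exact hK t
    · rw [image_eq_zero_of_notMem_tsupport fun h => ht (hsupp h), norm_zero]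
      exact mul_nonneg ((norm_nonneg _).trans (hK 0)) (norm_nonneg _)
  · rw [bump_of_ne h, norm_zero]
    exact mul_nonneg ((norm_nonneg _).trans (hK 0)) (norm_nonneg _)

/-- Integration over the tree of a function supported by one edge. -/
theorem integral_lengthMeasure_of_edge {F : T.Point → ℂ} (hF : Integrable F T.lengthMeasure)
    (e : T.Edge) (h : ∀ e', e' ≠ e → ∀ t, F (e', t) = 0) :
    ∫ x, F x ∂T.lengthMeasure = ∫ t in Set.Ioo 0 e.length, F (e, t) := by
  rw [lengthMeasure_eq_sum] at hF ⊢
  rw [integral_sum_measure hF, tsum_eq_single e]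
  · exact (measurableEmbedding_mk e).integral_map F
  · intro e' he'
    rw [(measurableEmbedding_mk e').integral_map F]
    simp [h e' he']

theorem integrableOn_edge {F : T.Point → ℂ} (hF : Integrable F T.lengthMeasure) (e : T.Edge) :
    IntegrableOn (fun t => F (e, t)) (Set.Ioo 0 e.length) := by
  rw [lengthMeasure_eq_sum] at hF
  exact (measurableEmbedding_mk e).integrable_map_iff.1 (hF.mono_measure (Measure.le_sum _ e))

theorem isBddMul_one (μ : Measure T.Point) : IsBddMul μ (fun _ => 1) 1 :=
  ⟨aestronglyMeasurable_const, Eventually.of_forall fun _ => by simp⟩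

/-- `H¹_{0,w}` is dense in `L²_w`. -/
theorem IsWeight.denseRange_valL (hw : IsWeight r c w) (hr : ∀ j, 0 < r j) (hc : 0 < c) :
    DenseRange (valL w) := by
  have hw0 : ∀ x ∈ T.body, 0 ≤ w x := fun x hx => (hw.pos hr hc hx).le
  suffices h : (LinearMap.range (valL w).toLinearMap)ᗮ = ⊥ by
    rw [← Submodule.topologicalClosure_eq_top_iff] at h
    exact (Submodule.dense_iff_topologicalClosure_eq_top).2 h
  rw [Submodule.eq_bot_iff]
  intro x hx
  have hint : ∀ f : T.L2 w, Integrable (fun y => ((1 * w y : ℝ) : ℂ) * x y * star (f y))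
      T.lengthMeasure := fun f =>
    IsBddMul.integrable_weighted hw.measurable hw0 (isBddMul_one _) x f
  have hinner : ∀ f : T.L2 w, inner ℂ f x =
      ∫ y, ((1 * w y : ℝ) : ℂ) * x y * star (f y) ∂T.lengthMeasure := by
    intro f
    rw [← IsBddMul.inner_mulOp_weighted hw.measurable hw0 (isBddMul_one _)]
    congr 1
    ext1
    filter_upwards [(isBddMul_one (T.weighted w)).coeFn_mulOp x] with y hy
    rw [hy, Complex.ofReal_one, one_mul]
  -- The fundamental lemma of the calculus of variations, with test functions supported in a single
  -- edge.
  have hedge : ∀ e : T.Edge, ∀ᵐ t, t ∈ Set.Ioo 0 e.length → (w (e, t) : ℂ) * x (e, t) = 0 := by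
    intro e
    refine isOpen_Ioo.ae_eq_zero_of_integral_contDiff_smul_eq_zero ?_ fun g hg hgc hgs => ?_
    · refine IntegrableOn.locallyIntegrableOn ?_
      refine (integrableOn_edge (hint (edgeIndicator hw e)) e).congr ?_
      filter_upwards [ae_lengthMeasure_iff.1 ((hw.ae_weighted hr hc) ▸ coeFn_edgeIndicator hw e) e,
        ae_restrict_mem measurableSet_Ioo] with t h1 ht
      rw [h1, Set.indicator_of_mem (mem_cell_one_zero_iff.2 ⟨rfl, ht⟩), star_one, mul_one, one_mul]
    · have hgd : Continuous (deriv g) := hg.continuous_deriv (by simp)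
      have hu := memLp_bump hw e hg.continuous hgs hgc
      have hu' := memLp_bump hw e hgd ((closure_minimal support_deriv_subset (isClosed_tsupport g)).trans hgs)
        hgc.deriv
      have hmem : (hu.toLp, hu'.toLp) ∈ H10 w :=
        subset_closure ⟨bump e g, isC10_bump e hg hgs, hu.coeFn_toLp, by
          rw [edgeDeriv_bump e hg]
          exact hu'.coeFn_toLp⟩
      have h0 : inner ℂ (hu.toLp : T.L2 w) x = 0 :=
        hx _ ⟨formDomain.mk _ hmem, rfl⟩
      have hae : (fun y => ((1 * w y : ℝ) : ℂ) * x y * star ((hu.toLp : T.L2 w) y))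
          =ᵐ[T.lengthMeasure] fun y => ((1 * w y : ℝ) : ℂ) * x y * star (bump e g y) := by
        have := hu.coeFn_toLp
        rw [EventuallyEq, hw.ae_weighted hr hc] at this
        filter_upwards [this] with y hy
        rw [hy]
      rw [hinner, integral_congr_ae hae, integral_lengthMeasure_of_edge
        ((hint hu.toLp).congr hae) e (fun e' he' t => by
          rw [bump_of_ne he', star_zero, mul_zero])] at h0
      rw [← h0, setIntegral_eq_integral_of_forall_compl_eq_zero]
      · refine integral_congr_ae (Eventually.of_forall fun t => ?_)
        simp only
        rw [bump_self, one_mul, Complex.real_smul]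
        change _ = _ * (starRingEnd ℂ) (g t : ℂ)
        rw [Complex.conj_ofReal]
        ring
      · intro t ht
        rw [bump_self, image_eq_zero_of_notMem_tsupport fun h => ht (hgs h)]
        simp
  have hzero : ∀ᵐ y ∂T.weighted w, x y = 0 := by
    rw [hw.ae_weighted hr hc, ae_lengthMeasure_iff]
    intro e
    rw [ae_restrict_iff' measurableSet_Ioo]
    filter_upwards [hedge e] with t h1 ht
    have h2 : (w (e, t) : ℂ) ≠ 0 := by
      exact_mod_cast (hw.pos hr hc (x := (e, t)) ht).ne'
    exact (mul_eq_zero.1 (h1 ht)).resolve_left h2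
  ext1
  filter_upwards [hzero, Lp.coeFn_zero ℂ 2 (T.weighted w)] with y h1 h2
  rw [h1, h2, Pi.zero_apply]

end RadialTree

/-! ### Vertex neighbourhoods and the energy operators -/

namespace RadialTree

variable {T : RadialTree} {r : ℕ → ℝ} {c : ℝ} {w ρ₁ ρ₂ W : T.Point → ℝ} {K : ℝ}

theorem height_mono : Monotone T.height :=
  monotone_nat_of_le_succ fun j => by
    rw [height, height, Finset.sum_range_succ]
    linarith [T.len_pos j]

theorem meetGen_le (e : T.Edge) (v : T.Vertex) : meetGen e v ≤ e.gen + 1 ∧ meetGen e v ≤ v.gen := by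
  have h := Nat.sSup_mem (s := {p : ℕ | p ≤ e.1 + 1 ∧ p ≤ v.1 ∧
    ∀ (i : ℕ) (h₁ : i < e.1 + 1) (h₂ : i < v.1), i < p → (e.2 ⟨i, h₁⟩ : ℕ) = v.2 ⟨i, h₂⟩})
    ⟨0, by simp⟩ ⟨e.1 + 1, fun p hp => hp.1⟩
  exact ⟨h.1, h.2.1⟩

/-- The distance to a vertex is at least the distance to the nearer end point of the edge. -/
theorem min_le_distVertex {x : T.Point} (hx : x ∈ T.body) (v : T.Vertex) :
    min x.2 (x.1.length - x.2) ≤ distVertex x v := by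
  obtain ⟨h1, h2⟩ := meetGen_le x.1 v
  have hv := height_mono (T := T) h2
  have hx1 : 0 < x.2 := hx.1
  have hx2 : x.2 < x.1.length := hx.2
  rw [distVertex]
  -- If the whole word of the edge is a prefix of `v`, the path to `v` leaves the edge at its lower
  -- end; otherwise it leaves at the upper end.
  rcases Nat.lt_or_ge x.1.gen (meetGen x.1 v) with h | h
  · have h3 : meetGen x.1 v = x.1.gen + 1 := by omega
    have h4 : T.height (x.1.gen + 1) = T.height x.1.gen + x.1.length := by
      rw [height, Finset.sum_range_succ]
      rfl
    refine (min_le_right _ _).trans ?_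
    have h5 : min (absPt x) (T.height (meetGen x.1 v)) ≤ absPt x := min_le_left _ _
    rw [h3, h4] at hv
    simp only [absPt] at h5 ⊢
    linarith
  · refine (min_le_left _ _).trans ?_
    have h4 := height_mono (T := T) h
    have h5 : min (absPt x) (T.height (meetGen x.1 v)) ≤ T.height (meetGen x.1 v) := min_le_right _ _
    simp only [absPt] at h5 ⊢
    linarith

/-- Every point of an open edge eventually leaves the shrinking neighbourhoods of the vertices. -/
theorem eventually_forall_lt_distVertex (hsum : Summable T.len) (M : ℝ) {x : T.Point}
    (hx : x ∈ T.body) : ∀ᶠ n : ℕ in atTop, ∀ v : T.Vertex, M * T.len v.gen / n < distVertex x v := by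
  have hδ : 0 < min x.2 (x.1.length - x.2) := lt_min hx.1 (sub_pos.2 hx.2)
  -- A single edge length is at most the total, so the radii shrink uniformly in `v`; `|M|` covers
  -- either sign of `M`.
  have h1 : Tendsto (fun n : ℕ => |M| * (∑' j, T.len j) / n) atTop (𝓝 0) :=
    tendsto_const_div_atTop_nhds_zero_nat _
  filter_upwards [h1.eventually (gt_mem_nhds hδ)] with n hn v
  refine lt_of_le_of_lt ?_ (hn.trans_le (min_le_distVertex hx v))
  have h2 := hsum.le_tsum v.gen fun i _ => (T.len_pos i).le
  have h3 := (T.len_pos v.gen).le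
  have h4 : M * T.len v.gen ≤ |M| * T.len v.gen := mul_le_mul_of_nonneg_right (le_abs_self M) h3
  exact div_le_div_of_nonneg_right (h4.trans (mul_le_mul_of_nonneg_left h2 (abs_nonneg M)))
    (Nat.cast_nonneg n)

theorem IsContinuous.aemeasurable {f : T.Point → ℝ} (hf : IsContinuous f) :
    AEMeasurable f T.lengthMeasure :=
  aemeasurable_lengthMeasure fun e =>
    ((hf.1 e).mono Set.Ioo_subset_Icc_self).aemeasurable measurableSet_Ioo

theorem _root_.IsBddMul.weighted {m : T.Point → ℝ} (h : IsBddMul T.lengthMeasure m K)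
    (w : T.Point → ℝ) : IsBddMul (T.weighted w) m K :=
  ⟨h.aesm.mono_ac (withDensity_absolutelyContinuous _ _),
    (withDensity_absolutelyContinuous _ _).ae_le h.bound⟩

theorem IsWeight.isBddMul_div (h₁ : IsWeight r c ρ₁) (hw : IsWeight r c w) (hr : ∀ j, 0 < r j)
    (hc : 0 < c) : IsBddMul T.lengthMeasure (fun x => ρ₁ x / w x) (c ^ 2) := by
  refine ⟨(h₁.measurable.div hw.measurable).aestronglyMeasurable, ?_⟩
  filter_upwards [ae_mem_body] with x hx
  have h1 := h₁.pos hr hc hx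
  have h2 := hw.pos hr hc hx
  rw [abs_of_pos (div_pos h1 h2), div_le_iff₀ h2]
  exact h₁.le_mul hw hc hx

theorem IsWeight.le_div (h₁ : IsWeight r c ρ₁) (hw : IsWeight r c w) (hr : ∀ j, 0 < r j)
    (hc : 0 < c) : ∀ᵐ x ∂T.lengthMeasure, (c ^ 2)⁻¹ ≤ ρ₁ x / w x := by
  filter_upwards [ae_mem_body] with x hx
  have h2 := hw.pos hr hc hx
  rw [le_div_iff₀ h2, inv_mul_le_iff₀ (by positivity)]
  exact hw.le_mul h₁ hc hx

theorem IsWeight.isBddMul_mul_div (h₂ : IsWeight r c ρ₂) (hw : IsWeight r c w) (hr : ∀ j, 0 < r j)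
    (hc : 0 < c) (hW : IsBddMul T.lengthMeasure W K) :
    IsBddMul T.lengthMeasure (fun x => W x * (ρ₂ x / w x)) (|K| * c ^ 2) := by
  have h := h₂.isBddMul_div hw hr hc
  refine ⟨hW.aesm.mul h.aesm, ?_⟩
  filter_upwards [hW.bound, h.bound] with x h1 h2
  rw [abs_mul]
  exact mul_le_mul (h1.trans (le_abs_self K)) h2 (abs_nonneg _) (abs_nonneg _)

/-- The operator, on the form domain of the weight `w`, of the energy form with the weights
`ρ₁`, `ρ₂` and the potential `W`. -/
def energyOp (w ρ₁ ρ₂ W : T.Point → ℝ) : formDomain w →L[ℂ] formDomain w :=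
  formOp (valL w) (derivL w) (mulOp (T.weighted w) fun x => ρ₁ x / w x)
    (mulOp (T.weighted w) fun x => W x * (ρ₂ x / w x))

theorem IsWeight.inner_energyOp (hw : IsWeight r c w) (h₁ : IsWeight r c ρ₁)
    (h₂ : IsWeight r c ρ₂) (hr : ∀ j, 0 < r j) (hc : 0 < c) (hW : IsBddMul T.lengthMeasure W K)
    (q p : formDomain w) : inner ℂ q (energyOp w ρ₁ ρ₂ W p) =
      ∫ x, (derivL w p x * star (derivL w q x) * (ρ₁ x : ℂ) +
        (W x : ℂ) * valL w p x * star (valL w q x) * (ρ₂ x : ℂ)) ∂T.lengthMeasure := by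
  rw [energyOp, inner_formOp]
  refine (integral_energy_eq hw.measurable (fun x hx => (hw.pos hr hc hx).le)
    ((h₁.isBddMul_div hw hr hc).weighted w) ((h₂.isBddMul_mul_div hw hr hc hW).weighted w)
    (fun x hx => ?_) (fun x hx => ?_) (valL w p, derivL w p) (valL w q, derivL w q)).symm
  · have := (hw.pos hr hc hx).ne'
    field_simp
  · have := (hw.pos hr hc hx).ne'
    field_simp

theorem IsWeight.energyOp_isSymmetric (hw : IsWeight r c w) (h₁ : IsWeight r c ρ₁)
    (h₂ : IsWeight r c ρ₂) (hr : ∀ j, 0 < r j) (hc : 0 < c) (hW : IsBddMul T.lengthMeasure W K) :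
    (energyOp w ρ₁ ρ₂ W).IsSymmetric :=
  formOp_isSymmetric _ _ ((h₁.isBddMul_div hw hr hc).weighted w).mulOp_isSymmetric
    ((h₂.isBddMul_mul_div hw hr hc hW).weighted w).mulOp_isSymmetric

/-- The eigenvalue sequences of the operator, in terms of the energy operator. -/
theorem IsWeight.isEigenvalueSequence_iff (h₁ : IsWeight r c ρ₁) (h₂ : IsWeight r c ρ₂)
    (hr : ∀ j, 0 < r j) (hc : 0 < c) (hW : IsBddMul T.lengthMeasure W K) (ev : ℕ → ℝ) :
    IsEigenvalueSequence (operatorGraph ρ₁ ρ₂ W) ev ↔ Monotone ev ∧ Tendsto ev atTop atTop ∧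
      ∃ φ : HilbertBasis ℕ ℂ (T.L2 ρ₂), ∀ m, ∃ v, valL ρ₂ v = φ m ∧
        ∀ q, inner ℂ q (energyOp ρ₂ ρ₁ ρ₂ W v) = (ev m : ℂ) * inner ℂ (valL ρ₂ q) (φ m) := by
  refine and_congr_right fun _ => and_congr_right fun _ => exists_congr fun φ =>
    forall_congr' fun m => ?_
  constructor
  · rintro ⟨u', hu, h⟩
    refine ⟨formDomain.mk _ hu, rfl, fun q => ?_⟩
    rw [h₂.inner_energyOp h₁ h₂ hr hc hW, ← inner_smul_right]
    exact h _ (valL_derivL_mem_H10 q)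
  · rintro ⟨v, hv, h⟩
    refine ⟨derivL ρ₂ v, ?_, fun q hq => ?_⟩
    · rw [← hv]
      exact valL_derivL_mem_H10 v
    · have h3 := h (formDomain.mk q hq)
      rw [h₂.inner_energyOp h₁ h₂ hr hc hW, ← inner_smul_right] at h3
      rw [← hv] at h3 ⊢
      exact h3

/-- The ratio of the weights bounds the derivative part from below and `-K ≤ W` bounds the
potential. This gives semiboundedness for min-max and coercivity after a shift. -/
theorem IsWeight.le_re_inner_energyOp (h₁ : IsWeight r c ρ₁) (h₂ : IsWeight r c ρ₂)
    (hr : ∀ j, 0 < r j) (hc : 0 < c) (hW : IsBddMul T.lengthMeasure W K) (v : formDomain ρ₂) :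
    (c ^ 2)⁻¹ * ‖derivL ρ₂ v‖ ^ 2 - K * ‖valL ρ₂ v‖ ^ 2 ≤
      (inner ℂ v (energyOp ρ₂ ρ₁ ρ₂ W v)).re := by
  have hA := ((h₁.isBddMul_div h₂ hr hc).weighted ρ₂).le_re_inner_mulOp
    ((withDensity_absolutelyContinuous _ _).ae_le (h₁.le_div h₂ hr hc)) (derivL ρ₂ v)
  have hQ := ((h₂.isBddMul_mul_div h₂ hr hc hW).weighted ρ₂).le_re_inner_mulOp (a := -K)
    ((withDensity_absolutelyContinuous _ _).ae_le (by
      filter_upwards [hW.bound, ae_mem_body] with x hx hb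
      rw [div_self (h₂.pos hr hc hb).ne', mul_one]
      exact (abs_le.1 hx).1)) (valL ρ₂ v)
  rw [energyOp, inner_formOp, Complex.add_re]
  linarith

/-- The operator has purely discrete spectrum. -/
theorem IsWeight.exists_isEigenvalueSequence (h₁ : IsWeight r c ρ₁) (h₂ : IsWeight r c ρ₂)
    (hr : ∀ j, 0 < r j) (hc : 0 < c) (hW : IsBddMul T.lengthMeasure W K)
    (hcomp : IsCompactOperator (valL ρ₂)) :
    ∃ ev, IsEigenvalueSequence (operatorGraph ρ₁ ρ₂ W) ev := by
  set B := energyOp ρ₂ ρ₁ ρ₂ W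
  have hBsymm : B.IsSymmetric := h₂.energyOp_isSymmetric h₁ h₂ hr hc hW
  obtain ⟨ev, φ, hmono, htop, hφ⟩ := exists_form_eigenbasis (valL ρ₂) hcomp
    (h₂.denseRange_valL hr hc) (not_finiteDimensional_L2 h₂ hr hc)
    -- `K` compensates the potential and the extra `1` makes the form coercive in `u` itself; the
    -- eigenvalues are shifted back below.
    (shiftOp (valL ρ₂) B (K + 1)) (shiftOp_isSymmetric _ hBsymm _)
    (α := min (c ^ 2)⁻¹ 1) (by positivity) (fun v => by
      have h3 := h₁.le_re_inner_energyOp h₂ hr hc hW v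
      rw [re_inner_shiftOp, norm_sq_formDomain]
      have h5 := mul_le_mul_of_nonneg_right (min_le_left (c ^ 2)⁻¹ 1) (sq_nonneg ‖derivL ρ₂ v‖)
      have h6 := mul_le_mul_of_nonneg_right (min_le_right (c ^ 2)⁻¹ 1) (sq_nonneg ‖valL ρ₂ v‖)
      linarith)
  refine ⟨fun m => ev m - (K + 1), (h₁.isEigenvalueSequence_iff h₂ hr hc hW _).2
    ⟨fun a b hab => sub_le_sub_right (hmono hab) _, tendsto_atTop_add_const_right _ _ htop, φ,
      fun m => ?_⟩⟩
  obtain ⟨v, hv, h⟩ := hφ m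
  refine ⟨v, hv, fun q => ?_⟩
  have h3 := h q
  rw [inner_shiftOp, hv] at h3
  rw [eq_sub_of_add_eq h3]
  push_cast
  ring

theorem IsWeight.isMinMaxSystem (h₁ : IsWeight r c ρ₁) (h₂ : IsWeight r c ρ₂)
    (hr : ∀ j, 0 < r j) (hc : 0 < c) (hW : IsBddMul T.lengthMeasure W K) {ev : ℕ → ℝ}
    (hev : IsEigenvalueSequence (operatorGraph ρ₁ ρ₂ W) ev) :
    IsMinMaxSystem (valL ρ₂) (energyOp ρ₂ ρ₁ ρ₂ W) (ContinuousLinearMap.id ℂ _) ev := by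
  obtain ⟨hmono, -, φ, hφ⟩ := (h₁.isEigenvalueSequence_iff h₂ hr hc hW ev).1 hev
  refine isMinMaxSystem_of_eigenbasis (κ := K) (h₂.energyOp_isSymmetric h₁ h₂ hr hc hW)
    (fun v => ?_) hmono φ hφ
  have h3 := h₁.le_re_inner_energyOp h₂ hr hc hW v
  have : 0 ≤ (c ^ 2)⁻¹ * ‖derivL ρ₂ v‖ ^ 2 := by positivity
  linarith

/-- The variational characterisation, transported to the form domain of the weight `w`. -/
theorem IsWeight.isMinMaxSystem_transport (hw : IsWeight r c w) (h₁ : IsWeight r c ρ₁)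
    (h₂ : IsWeight r c ρ₂) (hr : ∀ j, 0 < r j) (hc : 0 < c) (hW : IsBddMul T.lengthMeasure W K)
    {ev : ℕ → ℝ} (hev : IsEigenvalueSequence (operatorGraph ρ₁ ρ₂ W) ev) :
    IsMinMaxSystem (valL w) (energyOp w ρ₁ ρ₂ W)
      (mulOp (T.weighted w) fun x => ρ₂ x / w x) ev := by
  have ha := h₂.weighted_le hw hc
  have hb := hw.weighted_le h₂ hc
  have hcoe : ∀ f : T.L2 w, changeWeight ENNReal.ofReal_ne_top ha f =ᵐ[T.lengthMeasure] f := by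
    intro f
    have := coeFn_changeWeight ENNReal.ofReal_ne_top ha f
    rwa [EventuallyEq, h₂.ae_weighted hr hc] at this
  refine (h₁.isMinMaxSystem h₂ hr hc hW hev).transport
    (formDomainEquiv ENNReal.ofReal_ne_top ha ENNReal.ofReal_ne_top hb)
    (changeWeight ENNReal.ofReal_ne_top ha).toLinearMap
    (Function.LeftInverse.injective
      (changeWeight_changeWeight ENNReal.ofReal_ne_top ha ENNReal.ofReal_ne_top hb))
    (fun v => rfl) (fun x y => ?_) (fun x y => ?_)
  · rw [h₂.inner_energyOp h₁ h₂ hr hc hW, hw.inner_energyOp h₁ h₂ hr hc hW]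
    refine integral_congr_ae ?_
    filter_upwards [hcoe (valL w x), hcoe (valL w y), hcoe (derivL w x), hcoe (derivL w y)]
      with z h3 h4 h5 h6
    change (changeWeight ENNReal.ofReal_ne_top ha (derivL w y) z *
      star (changeWeight ENNReal.ofReal_ne_top ha (derivL w x) z) * _ +
      _ * (changeWeight ENNReal.ofReal_ne_top ha (valL w y)) z *
      star ((changeWeight ENNReal.ofReal_ne_top ha (valL w x)) z) * _ : ℂ) = _
    rw [h3, h4, h5, h6]
  · change inner ℂ (changeWeight ENNReal.ofReal_ne_top ha (valL w x))
      (changeWeight ENNReal.ofReal_ne_top ha (valL w y)) = _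
    have hone : ∀ f : T.L2 ρ₂, mulOp (T.weighted ρ₂) (fun _ => 1) f = f := fun f => by
      ext1
      filter_upwards [(isBddMul_one (T.weighted ρ₂)).coeFn_mulOp f] with z hz
      rw [hz, Complex.ofReal_one, one_mul]
    rw [← hone (changeWeight ENNReal.ofReal_ne_top ha (valL w y)),
      IsBddMul.inner_mulOp_weighted h₂.measurable (fun z hz => (h₂.pos hr hc hz).le)
        (isBddMul_one _), IsBddMul.inner_mulOp_weighted hw.measurable
        (fun z hz => (hw.pos hr hc hz).le) ((h₂.isBddMul_div hw hr hc).weighted w)]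
    refine integral_congr_ae ?_
    filter_upwards [hcoe (valL w x), hcoe (valL w y), ae_mem_body] with z h3 h4 hz
    rw [h3, h4, one_mul, div_mul_cancel₀ _ (hw.pos hr hc hz).ne']

end RadialTree

end

/-! ### Assembly of the theorem -/

theorem mainTheorem4 (T : RadialTree) (hR : T.FiniteRadius)
    -- the limit weight: a positive constant on the edges of each generation
    (r : ℕ → ℝ) (hr : ∀ j, 0 < r j)
    -- the lower bound `C g(s) ρ(s) ≤ g(t) ρ(t)` for `s ≤ t`
    (C : ℝ) (hC : 0 < C)
    (hgrowth : ∀ i j, i ≤ j → C * ((T.edgeCount i : ℝ) * r i) ≤ (T.edgeCount j : ℝ) * r j)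
    (ρ : T.Point → ℝ) (hρ : ∀ x, ρ x = r x.1.gen)
    -- the weights, uniformly comparable to `ρ`
    (ρ₁ ρ₂ : ℕ → T.Point → ℝ)
    (hm₁ : ∀ n, 1 ≤ n → Measurable (ρ₁ n)) (hm₂ : ∀ n, 1 ≤ n → Measurable (ρ₂ n))
    (c : ℝ) (hc : 0 < c)
    (hcomp : ∀ n, 1 ≤ n → ∀ x ∈ T.body,
      c⁻¹ ≤ ρ₁ n x / ρ x ∧ ρ₁ n x / ρ x ≤ c ∧ c⁻¹ ≤ ρ₂ n x / ρ x ∧ ρ₂ n x / ρ x ≤ c)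
    -- they equal `ρ` outside `O(|e_j| / n)`-neighborhoods of the vertices of generation `j`
    (M : ℝ)
    (hnear : ∀ n : ℕ, 1 ≤ n → ∀ x ∈ T.body,
      (∀ v : T.Vertex, M * T.len v.gen / n < RadialTree.distVertex x v) →
        ρ₁ n x = ρ x ∧ ρ₂ n x = ρ x)
    -- the potentials
    (Wn : ℕ → T.Point → ℝ) (W : T.Point → ℝ)
    (hWcont : ∀ n, 1 ≤ n → RadialTree.IsContinuous (Wn n))
    (CW : ℝ) (hWbdd : ∀ n, 1 ≤ n → ∀ x ∈ T.body, |Wn n x| ≤ CW)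
    (hWlim : ∀ᵐ x ∂T.lengthMeasure, Tendsto (fun n => Wn n x) atTop (𝓝 (W x))) :
    -- the operators have purely discrete spectrum, and their eigenvalues converge
    (∀ n, 1 ≤ n → ∃ ev : ℕ → ℝ,
      IsEigenvalueSequence (RadialTree.operatorGraph (ρ₁ n) (ρ₂ n) (Wn n)) ev) ∧
    (∃ ev : ℕ → ℝ, IsEigenvalueSequence (RadialTree.operatorGraph ρ ρ W) ev) ∧
    ∀ (evn : ℕ → ℕ → ℝ) (ev : ℕ → ℝ),
      (∀ n, 1 ≤ n → IsEigenvalueSequence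
        (RadialTree.operatorGraph (ρ₁ n) (ρ₂ n) (Wn n)) (evn n)) →
      IsEigenvalueSequence (RadialTree.operatorGraph ρ ρ W) ev →
      ∀ m, Tendsto (fun n => evn n m) atTop (𝓝 (ev m)) := by
  -- Comparability at one midpoint with `n = 1` forces `1 ≤ c`, so that `ρ` itself is a weight with
  -- the same constant.
  have hc1 : c⁻¹ ≤ c := by
    let e : T.Edge := (Classical.arbitrary (T.Word 0)).edge
    have hl := e.length_pos
    have hx : (e, e.length / 2) ∈ T.body :=
      ⟨half_pos hl, half_lt_self hl⟩
    have h := hcomp 1 le_rfl _ hx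
    exact h.1.trans h.2.1
  have hsum := hR.summable_len
  have hρpos : ∀ x, 0 < ρ x := fun x => by
    rw [hρ]
    exact hr _
  have hw : RadialTree.IsWeight r c ρ := by
    have hone : 1 ≤ c := by
      by_contra! h
      exact absurd hc1 (not_le.2 (h.trans (one_lt_inv₀ hc |>.2 h)))
    refine ⟨?_, fun x _ => ?_, fun x _ => ?_⟩
    · have : ρ = (fun e : T.Edge => r e.gen) ∘ Prod.fst := funext hρ
      rw [this]
      exact measurable_from_top.comp measurable_fst
    · rw [hρ]
      exact mul_le_of_le_one_left (hr _).le (inv_le_one_of_one_le₀ hone)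
    · rw [hρ]
      exact le_mul_of_one_le_left (hr _).le hone
  have hw₁ : ∀ n, 1 ≤ n → RadialTree.IsWeight r c (ρ₁ n) := fun n hn =>
    ⟨hm₁ n hn, fun x hx => by
      have h := (hcomp n hn x hx).1
      rwa [le_div_iff₀ (hρpos x), hρ] at h, fun x hx => by
      have h := (hcomp n hn x hx).2.1
      rwa [div_le_iff₀ (hρpos x), hρ] at h⟩
  have hw₂ : ∀ n, 1 ≤ n → RadialTree.IsWeight r c (ρ₂ n) := fun n hn =>
    ⟨hm₂ n hn, fun x hx => by
      have h := (hcomp n hn x hx).2.2.1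
      rwa [le_div_iff₀ (hρpos x), hρ] at h, fun x hx => by
      have h := (hcomp n hn x hx).2.2.2
      rwa [div_le_iff₀ (hρpos x), hρ] at h⟩
  have hWn : ∀ n, 1 ≤ n → IsBddMul T.lengthMeasure (Wn n) CW := fun n hn =>
    ⟨(hWcont n hn).aemeasurable.aestronglyMeasurable, by
      filter_upwards [RadialTree.ae_mem_body] with x hx
      exact hWbdd n hn x hx⟩
  have hW : IsBddMul T.lengthMeasure W CW := by
    -- `W` is measurable only as an almost everywhere limit; the index is shifted since the
    -- assumptions on `Wn` start at `n = 1`.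
    refine ⟨aestronglyMeasurable_of_tendsto_ae atTop (f := fun n => Wn (n + 1))
      (fun n => (hWn (n + 1) (by omega)).aesm) ?_, ?_⟩
    · filter_upwards [hWlim] with x hx
      exact (tendsto_add_atTop_iff_nat 1).2 hx
    · filter_upwards [hWlim, RadialTree.ae_mem_body] with x hx hb
      refine le_of_tendsto hx.abs ?_
      filter_upwards [eventually_ge_atTop 1] with n hn
      exact hWbdd n hn x hb
  have hcpt : ∀ w, RadialTree.IsWeight r c w → IsCompactOperator (RadialTree.valL (T := T) w) :=
    fun w h => h.isCompactOperator_valL hr hc hC hgrowth hsum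
  refine ⟨fun n hn => (hw₁ n hn).exists_isEigenvalueSequence (hw₂ n hn) hr hc (hWn n hn)
    (hcpt _ (hw₂ n hn)), hw.exists_isEigenvalueSequence hw hr hc hW (hcpt _ hw),
    fun evn ev hevn hev m => ?_⟩
  have hge : ∀ᶠ n : ℕ in atTop, 1 ≤ n := eventually_ge_atTop 1
  have hac : T.weighted ρ ≪ T.lengthMeasure := withDensity_absolutelyContinuous _ _
  -- At a fixed point of an open edge the weights are eventually equal to `ρ`, not merely close to
  -- it.
  have hρlim : ∀ᵐ x ∂T.weighted ρ, ∀ᶠ n in atTop, ρ₁ n x = ρ x ∧ ρ₂ n x = ρ x := by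
    filter_upwards [hac.ae_le RadialTree.ae_mem_body] with x hx
    filter_upwards [hge, RadialTree.eventually_forall_lt_distVertex hsum M hx] with n hn h
    exact hnear n hn x hx h
  -- The quotients `ρ x / ρ x` are kept so that the limit form is `energyOp ρ ρ ρ W` by definition.
  refine tendsto_eigenvalues (j := RadialTree.valL ρ) (π := RadialTree.derivL ρ)
    (A := fun n => mulOp (T.weighted ρ) fun x => ρ₁ n x / ρ x)
    (Q := fun n => mulOp (T.weighted ρ) fun x => Wn n x * (ρ₂ n x / ρ x))
    (R := fun n => mulOp (T.weighted ρ) fun x => ρ₂ n x / ρ x)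
    (A₀ := mulOp (T.weighted ρ) fun x => ρ x / ρ x)
    (Q₀ := mulOp (T.weighted ρ) fun x => W x * (ρ x / ρ x))
    (K := max (c ^ 2) (|CW| * c ^ 2)) (α := (c ^ 2)⁻¹) (hcpt _ hw)
    RadialTree.norm_sq_formDomain (by positivity) ?_ ?_ ?_ ?_ ?_ ?_ ?_ ?_ ?_
    (hw.isMinMaxSystem hw hr hc hW hev) m
  · filter_upwards [hge] with n hn
    exact ((((hw₂ n hn).isBddMul_mul_div hw hr hc (hWn n hn)).weighted ρ).norm_mulOp_le
      (by positivity)).trans (le_max_right _ _)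
  · filter_upwards [hge] with n hn
    exact ((((hw₂ n hn).isBddMul_div hw hr hc).weighted ρ).norm_mulOp_le
      (by positivity)).trans (le_max_left _ _)
  · filter_upwards [hge] with n hn
    exact (((hw₁ n hn).isBddMul_div hw hr hc).weighted ρ).mulOp_isSymmetric
  · filter_upwards [hge] with n hn
    exact (((hw₁ n hn).isBddMul_div hw hr hc).weighted ρ).le_re_inner_mulOp
      (hac.ae_le ((hw₁ n hn).le_div hw hr hc))
  · filter_upwards [hge] with n hn
    exact (((hw₂ n hn).isBddMul_div hw hr hc).weighted ρ).le_re_inner_mulOp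
      (hac.ae_le ((hw₂ n hn).le_div hw hr hc))
  · refine tendsto_mulOp (K := c ^ 2) ?_ ((hw.isBddMul_div hw hr hc).weighted ρ) ?_
    · filter_upwards [hge] with n hn
      exact ((hw₁ n hn).isBddMul_div hw hr hc).weighted ρ
    · filter_upwards [hρlim] with x hx
      refine tendsto_const_nhds.congr' ?_
      filter_upwards [hx] with n hn
      rw [hn.1]
  · refine tendsto_mulOp (K := |CW| * c ^ 2) ?_ ((hw.isBddMul_mul_div hw hr hc hW).weighted ρ) ?_
    · filter_upwards [hge] with n hn
      exact ((hw₂ n hn).isBddMul_mul_div hw hr hc (hWn n hn)).weighted ρ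
    · filter_upwards [hρlim, hac.ae_le hWlim] with x hx hWx
      refine (hWx.mul_const (ρ x / ρ x)).congr' ?_
      filter_upwards [hx] with n hn
      rw [hn.2]
  · intro h
    have hone : mulOp (T.weighted ρ) (fun x => ρ x / ρ x) h = h := by
      ext1
      filter_upwards [((hw.isBddMul_div hw hr hc).weighted ρ).coeFn_mulOp h] with x hx
      rw [hx, div_self (hρpos x).ne', Complex.ofReal_one, one_mul]
    conv =>
      enter [3, 1]
      rw [← hone]
    refine tendsto_mulOp (K := c ^ 2) ?_ ((hw.isBddMul_div hw hr hc).weighted ρ) ?_ h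
    · filter_upwards [hge] with n hn
      exact ((hw₂ n hn).isBddMul_div hw hr hc).weighted ρ
    · filter_upwards [hρlim] with x hx
      refine tendsto_const_nhds.congr' ?_
      filter_upwards [hx] with n hn
      rw [hn.2]
  · filter_upwards [hge] with n hn
    exact hw.isMinMaxSystem_transport (hw₁ n hn) (hw₂ n hn) hr hc (hWn n hn) (hevn n hn)
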